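/- For $r_1,r_2,\varepsilon>0$ let $D_1,D_2\subset\mathbb R^2$ be the disks with radii $r_1,r_2$ and centres $\mathbf c_1=(r_1+\varepsilon,0)$, $\mathbf c_2=(-r_2-\varepsilon,0)$, let $R_i(\mathbf x)=\frac{r_i^2(\mathbf x-\mathbf c_i)}{|\mathbf x-\mathbf c_i|^2}+\mathbf c_i$ be the reflection in $\partial D_i$, and let $\Omega=B_{4(r_1+r_2)}(0)$. For an entire harmonic function $H$ on $\mathbb R^2$, let $u$ be the solution, $C^1$ up to the boundary, of $$\Delta u=0\ \text{ in }\mathbb R^2\setminus\overline{D_1\cup D_2},\qquad u(\mathbf x)-H(\mathbf x)=O(|\mathbf x|^{-1})\ \text{ as }|\mathbf x|\to\infty,$$ $$u|_{\partial D_i}=C_i\ \text{(a constant)},\qquad \int_{\partial D_i}\partial_\nu u\,dS=0,\qquad i=1,2.$$ 1. For all $r_1,r_2,\varepsilon>0$, the map $R_1\circ R_2$ has exactly one fixed point $\mathbf p_1$ in $D_1$, the map $R_2\circ R_1$ has exactly one fixed point $\mathbf p_2$ in $D_2$, $R_2(\mathbf p_1)=\mathbf p_2$ and $R_1(\mathbf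 p_2)=\mathbf p_1$. Moreover, for every entire harmonic $H$, $$u|_{\partial D_1}-u|_{\partial D_2}=H(\mathbf p_1)-H(\mathbf p_2).$$ 2. For every entire harmonic $H$, $$H(\mathbf p_1)-H(\mathbf p_2)=4\,\partial_{x_1}H(0,0)\sqrt{\frac{r_1r_2}{r_1+r_2}}\,\sqrt\varepsilon+O(\varepsilon),$$ where $|O(\varepsilon)|\le K\varepsilon$ for all $0<\varepsilon\le1$ and all $r_1,r_2>0$ with $\frac{r_1r_2}{r_1+r_2}\le M$, the constant $K$ depending only on $H$ and $M$. 3. For every entire harmonic $H$ and all $r_1,r_2>0$ there is $\varepsilon_0>0$ such that for all $0<\varepsilon<\varepsilon_0$ there is a point $\mathbf x_2$ of the open segment from $(-\varepsilon,0)$ to $(\varepsilon,0)$, the segment that joins the closest points of $\partial D_2$ and $\partial D_1$, with $$|\nabla u(\mathbf x_2)|\ge|\partial_{x_1}H(0,0)|\sqrt{\frac{r_1r_2}{r_1+r_2}}\,\frac1{\sqrt\varepsilon}.$$ 4. There is an absolute constant $C>0$ such that for all $r_1,r_2>0$ there is $\varepsilon_0>0$ (depending only on $r_1,r_2$) such that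 for all $0<\varepsilon<\varepsilon_0$ and every entire harmonic $H$, $$\|\nabla u\|_{L^\infty(\Omega\setminus(D_1\cup D_2))}\le C\,\|\nabla H\|_{L^\infty(\Omega)}\sqrt{\frac{r_1r_2}{r_1+r_2}}\,\frac1{\sqrt\varepsilon}.$$ -/

import Mathlib

open Set Filter Topology MeasureTheory Metric

noncomputable section

/-- The Euclidean plane. -/
abbrev Plane : Type := EuclideanSpace ℝ (Fin 2)

namespace TwoDisks

/-- The centre `(r₁ + ε, 0)` of the first disk. -/
def center₁ (r₁ ε : ℝ) : Plane := !₂[r₁ + ε, 0]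

/-- The centre `(-r₂ - ε, 0)` of the second disk. -/
def center₂ (r₂ ε : ℝ) : Plane := !₂[-r₂ - ε, 0]

/-- The first disk `D₁`, of radius `r₁`. -/
def disk₁ (r₁ ε : ℝ) : Set Plane := ball (center₁ r₁ ε) r₁

/-- The second disk `D₂`, of radius `r₂`, at distance `2 ε` from the first one. -/
def disk₂ (r₂ ε : ℝ) : Set Plane := ball (center₂ r₂ ε) r₂

/-- The reflection `x ↦ r₁² (x - c₁) / |x - c₁|² + c₁` in the circle `∂D₁`. -/
def reflection₁ (r₁ ε : ℝ) : Plane → Plane := EuclideanGeometry.inversion (center₁ r₁ ε) r₁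

/-- The reflection `x ↦ r₂² (x - c₂) / |x - c₂|² + c₂` in the circle `∂D₂`. -/
def reflection₂ (r₂ ε : ℝ) : Plane → Plane := EuclideanGeometry.inversion (center₂ r₂ ε) r₂

/-- `p` is a fixed point of `R₁ ∘ R₂` lying in `D₁`. -/
def IsFixedPoint₁ (r₁ r₂ ε : ℝ) (p : Plane) : Prop :=
  p ∈ disk₁ r₁ ε ∧ reflection₁ r₁ ε (reflection₂ r₂ ε p) = p

/-- `p` is a fixed point of `R₂ ∘ R₁` lying in `D₂`. -/
def IsFixedPoint₂ (r₁ r₂ ε : ℝ) (p : Plane) : Prop :=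
  p ∈ disk₂ r₂ ε ∧ reflection₂ r₂ ε (reflection₁ r₁ ε p) = p

/-- `H` is an entire harmonic function. -/
def EntireHarmonic (H : Plane → ℝ) : Prop := InnerProductSpace.HarmonicOnNhd H univ

/-- The unit vector `(cos θ, sin θ)`; it is the outward unit normal to a circle with centre `c`
and radius `r` at the point `c + r (cos θ, sin θ)`. -/
def unitVec (θ : ℝ) : Plane := !₂[Real.cos θ, Real.sin θ]

/-- The flux `∫ G · ν dS` of a vector field `G` through the circle with centre `c` and
radius `r`, where `ν` is the outward unit normal and `dS = r dθ` is arc length. -/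
def circleFlux (G : Plane → Plane) (c : Plane) (r : ℝ) : ℝ :=
  ∫ θ in (0 : ℝ)..2 * Real.pi, inner ℝ (G (c + r • unitVec θ)) (unitVec θ) * r

/-- `u` is a (classical) solution of the perfect conductivity problem in the background
potential `H`, with boundary values `C₁` on `∂D₁` and `C₂` on `∂D₂`. The solution is continuously
differentiable up to the boundary: its gradient in the exterior of the disks extends to a field
`G` that is continuous up to the two circles, and the normal derivative `∂_ν u` on `∂Dᵢ` is
`G · ν`. The values of `u` inside the disks play no role. -/
structure IsSolution (r₁ r₂ ε : ℝ) (H u : Plane → ℝ) (C₁ C₂ : ℝ) : Prop where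
  harmonic : InnerProductSpace.HarmonicOnNhd u (closure (disk₁ r₁ ε ∪ disk₂ r₂ ε))ᶜ
  continuousOn : ContinuousOn u (disk₁ r₁ ε ∪ disk₂ r₂ ε)ᶜ
  decay : (fun x => u x - H x) =O[Bornology.cobounded Plane] fun x => ‖x‖⁻¹
  boundary₁ : ∀ x ∈ sphere (center₁ r₁ ε) r₁, u x = C₁
  boundary₂ : ∀ x ∈ sphere (center₂ r₂ ε) r₂, u x = C₂
  flux : ∃ G : Plane → Plane, ContinuousOn G (disk₁ r₁ ε ∪ disk₂ r₂ ε)ᶜ ∧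
    (∀ x ∈ (closure (disk₁ r₁ ε ∪ disk₂ r₂ ε))ᶜ, G x = gradient u x) ∧
    circleFlux G (center₁ r₁ ε) r₁ = 0 ∧ circleFlux G (center₂ r₂ ε) r₂ = 0

/-- The factor `√(r₁ r₂ / (r₁ + r₂))`. -/
def radiusFactor (r₁ r₂ : ℝ) : ℝ := Real.sqrt (r₁ * r₂ / (r₁ + r₂))

/-- The partial derivative `∂H/∂x₁` at the origin. -/
def partialOne (H : Plane → ℝ) : ℝ := fderiv ℝ H 0 (EuclideanSpace.single 0 1)

/-- The `L^∞` norm on `S` of the gradient of `f`. -/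
def gradSup (f : Plane → ℝ) (S : Set Plane) : ENNReal :=
  eLpNorm (gradient f) ⊤ (volume.restrict S)

/-- The domain `Ω`, the ball with centre `0` and radius `4 (r₁ + r₂)`. -/
def bigDomain (r₁ r₂ : ℝ) : Set Plane := ball 0 (4 * (r₁ + r₂))

end TwoDisks

end

noncomputable section

namespace TwoDisks

open ComplexConjugate

/-! Identify the plane with ℂ and write H = Re f with f entire. There are real points a > 0 > b, one
in each disk, that are inverse to each other in both circles. By Apollonius, in the coordinate w =
(z - a)/(z - b) the circles are |w|² = k₁ and |w|² = 1/k₂ with k₁, k₂ < 1, and R₁ ∘ R₂ is the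
dilation by l = k₁k₂ < 1. Thus p₁ = a and p₂ = b (`LimitPoints.fixedPoint_iff`).

The solution comes from the method of images. `potential` sums f over all words in R₁ and R₂, with
the sign of the parity of the word, each nontrivial term diminished by its limit along the orbit, so
that the series converge geometrically. On ∂D₁ the words cancel in pairs and the real part is 0;
exchanging a and b changes the potential only by a constant, so on ∂D₂ the real part is H(b) - H(a).
A maximum principle in the exterior shows that u is this real part plus α + β log|w|
(`IsSolution.exists_eq_add_log`). The logarithm carries flux 2π through ∂D₁ and the potential none,
so β = 0 (`IsSolution.exists_eq_potential`). This gives the exact formula for C₁ - C₂.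

The sum and the product of a and b are explicit, whence a - b = 4√(mε) + O(ε) with m = r₁r₂/(r₁ +
r₂); Taylor's formula at 0 gives the asymptotics (`exists_asymptotics`). The mean value theorem on
the gap, of length 2ε, gives the lower bound. For the upper bound, the n-th image contributes at
most a constant times lⁿ sup|∇H| to the gradient, and 1/(1 - l) is at most a constant times √(m/ε)
(`LimitPointRelations.le_one_sub_multiplier`). -/

/-- The sum `∑ E (λⁿ w)` over the forward orbit of `w` under the dilation by `λ`. -/
def dilationSum (l : ℝ) (E : ℂ → ℂ) (w : ℂ) : ℂ := ∑' n : ℕ, E ((l : ℂ) ^ n * w)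

/-! ### Series over the orbit of a contraction of the unit disk. -/

section DilationSum

variable {l : ℝ} {E : ℂ → ℂ}

lemma exists_norm_le_mul_norm (hE : DifferentiableOn ℂ E (ball 0 1)) (h0 : E 0 = 0) {ρ : ℝ}
    (hρ : ρ < 1) : ∃ C : ℝ, 0 ≤ C ∧ ∀ v : ℂ, ‖v‖ ≤ ρ → ‖E v‖ ≤ C * ‖v‖ := by
  have hsub : closedBall (0 : ℂ) ρ ⊆ ball 0 1 := closedBall_subset_ball hρ
  have hc : ContinuousOn (deriv E) (closedBall 0 ρ) :=
    (hE.deriv isOpen_ball).continuousOn.mono hsub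
  obtain ⟨C, hC⟩ := (isCompact_closedBall (0 : ℂ) ρ).exists_bound_of_continuousOn hc
  refine ⟨max C 0, le_max_right _ _, fun v hv => ?_⟩
  have hv' : v ∈ closedBall (0 : ℂ) ρ := by simpa using hv
  have h0' : (0 : ℂ) ∈ closedBall (0 : ℂ) ρ := by simpa using (norm_nonneg v).trans hv
  have := (convex_closedBall (0 : ℂ) ρ).norm_image_sub_le_of_norm_deriv_le
    (fun x hx => hE.differentiableAt (isOpen_ball.mem_nhds (hsub hx)))
    (fun x hx => (hC x hx).trans (le_max_left C 0)) h0' hv'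
  simpa [h0] using this

lemma norm_dilation_le (hl0 : 0 ≤ l) (hl1 : l ≤ 1) (n : ℕ) (w : ℂ) :
    ‖(l : ℂ) ^ n * w‖ ≤ ‖w‖ := by
  rw [norm_mul, norm_pow, Complex.norm_real, Real.norm_of_nonneg hl0]
  exact mul_le_of_le_one_left (norm_nonneg w) (pow_le_one₀ hl0 hl1)

/-- Since E vanishes at the fixed point 0, it is O(|v|) on smaller disks, so the n-th term is O(lⁿ)
uniformly and the Weierstrass test applies. -/
lemma exists_summable_bound (hl0 : 0 ≤ l) (hl1 : l < 1) (hE : DifferentiableOn ℂ E (ball 0 1))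
    (h0 : E 0 = 0) {ρ : ℝ} (hρ : ρ < 1) :
    ∃ u : ℕ → ℝ, Summable u ∧ ∀ n, ∀ w ∈ ball (0 : ℂ) ρ, ‖E ((l : ℂ) ^ n * w)‖ ≤ u n := by
  obtain ⟨C, hC0, hC⟩ := exists_norm_le_mul_norm hE h0 hρ
  refine ⟨fun n => C * l ^ n, (summable_geometric_of_lt_one hl0 hl1).mul_left C, fun n w hw => ?_⟩
  have hw' : ‖w‖ ≤ ρ := by simpa using (mem_ball_zero_iff.1 hw).le
  refine (hC _ ((norm_dilation_le hl0 hl1.le n w).trans hw')).trans ?_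
  rw [norm_mul, norm_pow, Complex.norm_real, Real.norm_of_nonneg hl0]
  exact mul_le_mul_of_nonneg_left
    (mul_le_of_le_one_right (pow_nonneg hl0 n) (hw'.trans hρ.le)) hC0

lemma differentiableOn_dilation (hl0 : 0 ≤ l) (hl1 : l ≤ 1)
    (hE : DifferentiableOn ℂ E (ball 0 1)) (n : ℕ) :
    DifferentiableOn ℂ (fun w => E ((l : ℂ) ^ n * w)) (ball 0 1) := by
  refine hE.comp (by fun_prop) fun w hw => ?_
  rw [mem_ball_zero_iff] at hw ⊢
  exact (norm_dilation_le hl0 hl1 n w).trans_lt hw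

lemma exists_lt_one_mem_ball {w : ℂ} (hw : ‖w‖ < 1) : ∃ ρ < 1, w ∈ ball (0 : ℂ) ρ := by
  obtain ⟨ρ, h1, h2⟩ := exists_between hw
  exact ⟨ρ, h2, by simpa using h1⟩

lemma summable_dilation (hl0 : 0 ≤ l) (hl1 : l < 1) (hE : DifferentiableOn ℂ E (ball 0 1))
    (h0 : E 0 = 0) {w : ℂ} (hw : ‖w‖ < 1) : Summable fun n : ℕ => E ((l : ℂ) ^ n * w) := by
  obtain ⟨ρ, hρ, hwρ⟩ := exists_lt_one_mem_ball hw
  obtain ⟨u, hu, hb⟩ := exists_summable_bound hl0 hl1 hE h0 hρ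
  exact hu.of_norm_bounded fun n => hb n w hwρ

lemma dilationSum_eq_add (hl0 : 0 ≤ l) (hl1 : l < 1) (hE : DifferentiableOn ℂ E (ball 0 1))
    (h0 : E 0 = 0) {w : ℂ} (hw : ‖w‖ < 1) :
    dilationSum l E w = E w + dilationSum l E (l * w) := by
  rw [dilationSum, (summable_dilation hl0 hl1 hE h0 hw).tsum_eq_zero_add, dilationSum]
  simp [pow_succ, mul_assoc]

lemma dilationSum_conj (w : ℂ) :
    dilationSum l (fun v => conj (E (conj v))) w = conj (dilationSum l E (conj w)) := by
  simp [dilationSum, Complex.conj_tsum]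

lemma differentiableAt_dilationSum (hl0 : 0 ≤ l) (hl1 : l < 1)
    (hE : DifferentiableOn ℂ E (ball 0 1)) (h0 : E 0 = 0) {w : ℂ} (hw : ‖w‖ < 1) :
    DifferentiableAt ℂ (dilationSum l E) w := by
  obtain ⟨ρ, hρ, hwρ⟩ := exists_lt_one_mem_ball hw
  obtain ⟨u, hu, hb⟩ := exists_summable_bound hl0 hl1 hE h0 hρ
  exact (Complex.differentiableOn_tsum_of_summable_norm hu
    (fun n => (differentiableOn_dilation hl0 hl1.le hE n).mono (ball_subset_ball hρ.le))
    isOpen_ball hb).differentiableAt (isOpen_ball.mem_nhds hwρ)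

lemma hasSum_deriv_dilationSum (hl0 : 0 ≤ l) (hl1 : l < 1)
    (hE : DifferentiableOn ℂ E (ball 0 1)) (h0 : E 0 = 0) {w : ℂ} (hw : ‖w‖ < 1) :
    HasSum (fun n : ℕ => (l : ℂ) ^ n * deriv E ((l : ℂ) ^ n * w)) (deriv (dilationSum l E) w) := by
  obtain ⟨ρ, hρ, hwρ⟩ := exists_lt_one_mem_ball hw
  obtain ⟨u, hu, hb⟩ := exists_summable_bound hl0 hl1 hE h0 hρ
  have := Complex.hasSum_deriv_of_summable_norm hu
    (fun n => (differentiableOn_dilation hl0 hl1.le hE n).mono (ball_subset_ball hρ.le))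
    isOpen_ball hb hwρ
  have e : ∀ n : ℕ, deriv (fun w => E ((l : ℂ) ^ n * w)) w =
      (l : ℂ) ^ n * deriv E ((l : ℂ) ^ n * w) := fun n => by
    simpa using deriv_comp_mul_left ((l : ℂ) ^ n) E w
  simp only [e] at this
  exact this

/-- The chain rule puts lⁿ in front of the n-th derivative; the geometric series is the sole source
of the blow-up of the gradient as l tends to 1. -/
lemma norm_deriv_dilationSum_le (hl0 : 0 ≤ l) (hl1 : l < 1)
    (hE : DifferentiableOn ℂ E (ball 0 1)) (h0 : E 0 = 0) {w : ℂ} (hw : ‖w‖ < 1) {K : ℝ}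
    (hK : ∀ n : ℕ, ‖deriv E ((l : ℂ) ^ n * w)‖ ≤ K) :
    ‖deriv (dilationSum l E) w‖ ≤ K / (1 - l) := by
  have h := hasSum_deriv_dilationSum hl0 hl1 hE h0 hw
  rw [← h.tsum_eq]
  refine tsum_of_norm_bounded (g := fun n => K * l ^ n) ?_ fun n => ?_
  · simpa [div_eq_mul_inv] using (hasSum_geometric_of_lt_one hl0 hl1).mul_left K
  · rw [norm_mul, norm_pow, Complex.norm_real, Real.norm_of_nonneg hl0, mul_comm]
    exact mul_le_mul_of_nonneg_right (hK n) (pow_nonneg hl0 n)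

end DilationSum

/-- The inverse of the Möbius map `z ↦ (z - p) / (z - q)`. -/
def mobiusInv (p q : ℝ) (w : ℂ) : ℂ := (p - q * w) / (1 - w)

/-- The increment of `f` from `p`, in the coordinate `w = (z - p) / (z - q)`. -/
def increment (f : ℂ → ℂ) (p q : ℝ) (w : ℂ) : ℂ := f (mobiusInv p q w) - f p

/-! ### The Möbius coordinate and Apollonius circles. -/

section Mobius

variable {f : ℂ → ℂ} {p q : ℝ}

lemma one_sub_ne_zero {w : ℂ} (hw : ‖w‖ < 1) : 1 - w ≠ 0 := by
  intro h
  rw [← sub_eq_zero.1 h] at hw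
  simp at hw

lemma mobiusInv_mobius (hpq : p ≠ q) {z : ℂ} (hz : z ≠ q) :
    mobiusInv p q ((z - p) / (z - q)) = z := by
  have h1 : z - q ≠ 0 := sub_ne_zero.2 hz
  have h2 : (p : ℂ) - q ≠ 0 := by exact_mod_cast sub_ne_zero.2 hpq
  have h3 : 1 - (z - p) / (z - q) = (p - q) / (z - q) := by field_simp; ring
  rw [mobiusInv, h3]
  field_simp
  ring

lemma hasDerivAt_mobiusInv {w : ℂ} (hw : 1 - w ≠ 0) :
    HasDerivAt (mobiusInv p q) ((p - q) / (1 - w) ^ 2) w := by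
  have h1 : HasDerivAt (fun w : ℂ => (p : ℂ) - q * w) (-q) w := by
    simpa using ((hasDerivAt_id w).const_mul (q : ℂ)).const_sub (p : ℂ)
  have h2 : HasDerivAt (fun w : ℂ => 1 - w) (-1) w := (hasDerivAt_id w).const_sub 1
  refine (h1.div h2 hw).congr_deriv ?_
  ring

lemma hasDerivAt_mobius {z : ℂ} (hz : z ≠ q) :
    HasDerivAt (fun z : ℂ => (z - p) / (z - q)) ((p - q) / (z - q) ^ 2) z := by
  have h := ((hasDerivAt_id z).sub_const (p : ℂ)).div ((hasDerivAt_id z).sub_const (q : ℂ))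
    (sub_ne_zero.2 hz)
  refine h.congr_deriv ?_
  simp

lemma increment_zero : increment f p q 0 = 0 := by simp [increment, mobiusInv]

lemma increment_mobius (hpq : p ≠ q) {z : ℂ} (hz : z ≠ q) :
    increment f p q ((z - p) / (z - q)) = f z - f p := by
  rw [increment, mobiusInv_mobius hpq hz]

lemma increment_conj (w : ℂ) :
    increment (fun z => conj (f (conj z))) p q w = conj (increment f p q (conj w)) := by
  simp [increment, mobiusInv]

lemma hasDerivAt_increment (hf : Differentiable ℂ f) {w : ℂ} (hw : 1 - w ≠ 0) :
    HasDerivAt (increment f p q) (deriv f (mobiusInv p q w) * ((p - q) / (1 - w) ^ 2)) w :=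
  ((hf _).hasDerivAt.comp w (hasDerivAt_mobiusInv hw)).sub_const _

lemma differentiableOn_increment (hf : Differentiable ℂ f) :
    DifferentiableOn ℂ (increment f p q) (ball 0 1) := fun _ hw =>
  (hasDerivAt_increment hf (one_sub_ne_zero
    (mem_ball_zero_iff.1 hw))).differentiableAt.differentiableWithinAt

lemma normSq_mobiusInv_sub {w : ℂ} (hw : 1 - w ≠ 0) :
    Complex.normSq (mobiusInv p q w - p) =
      Complex.normSq w * Complex.normSq (mobiusInv p q w - q) := by
  have : mobiusInv p q w - p = w * (mobiusInv p q w - q) := by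
    rw [mobiusInv]; field_simp; ring
  rw [this, Complex.normSq_mul]

/-- A circle is an Apollonius circle of any pair of points inverse with respect to it. -/
lemma normSq_sub_mul_normSq {c r : ℝ} (hcq : c - q ≠ 0) (h : (c - p) * (c - q) = r ^ 2) (z : ℂ) :
    Complex.normSq (z - p) - (c - p) / (c - q) * Complex.normSq (z - q) =
      (1 - (c - p) / (c - q)) * (Complex.normSq (z - c) - r ^ 2) := by
  rw [← h]
  simp only [Complex.normSq_apply, Complex.sub_re, Complex.sub_im, Complex.ofReal_re,
    Complex.ofReal_im]
  field_simp
  ring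

/-- The Apollonius identity turns the disk around c into a disk |w|² ≤ k. It keeps all image points
inside the disks, where f' is controlled. -/
lemma norm_mobiusInv_sub_le {c r : ℝ} (hr : 0 ≤ r) (hcq : c - q ≠ 0)
    (h : (c - p) * (c - q) = r ^ 2) (hk : (c - p) / (c - q) < 1) {w : ℂ} (hw : ‖w‖ < 1)
    (hwk : ‖w‖ ^ 2 ≤ (c - p) / (c - q)) : ‖mobiusInv p q w - c‖ ≤ r := by
  have h1 := normSq_sub_mul_normSq hcq h (mobiusInv p q w)
  rw [normSq_mobiusInv_sub (one_sub_ne_zero hw), ← sub_mul, Complex.normSq_eq_norm_sq w] at h1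
  have h2 : Complex.normSq (mobiusInv p q w - c) - r ^ 2 ≤ 0 := by
    by_contra! hpos
    have := mul_pos (sub_pos.2 hk) hpos
    rw [← h1] at this
    nlinarith [Complex.normSq_nonneg (mobiusInv p q w - q)]
  rw [Complex.normSq_eq_norm_sq] at h2
  exact abs_le_of_sq_le_sq' (by linarith) hr |>.2

/-- If `μ |v|² ≤ 1` then `1 - μ v` is comparable to `1 - v`. -/
lemma norm_one_sub_le {μ : ℝ} {v : ℂ} (h0 : 0 ≤ μ) (h1 : μ < 1) (h : μ * ‖v‖ ^ 2 ≤ 1) :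
    ‖1 - v‖ ≤ (1 + 2 * ‖v‖) * ‖1 - μ * v‖ := by
  -- The hypothesis says √μ |v| ≤ 1, so |μv| ≤ √μ and |1 - μv| ≥ 1 - √μ ≥ (1 - μ)/2.
  set m := Real.sqrt μ
  have hm : m ^ 2 = μ := Real.sq_sqrt h0
  have hm0 : 0 ≤ m := Real.sqrt_nonneg μ
  have hm1 : m < 1 := by nlinarith
  have hmv : m * ‖v‖ ≤ 1 := by
    refine abs_le_of_sq_le_sq' (b := 1) ?_ zero_le_one |>.2
    rw [mul_pow, hm]; simpa using h
  have e1 : 1 - m ≤ ‖1 - μ * v‖ := by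
    have : ‖(1 : ℂ)‖ - ‖(μ : ℂ) * v‖ ≤ ‖1 - μ * v‖ := norm_sub_norm_le _ _
    rw [norm_one, norm_mul, Complex.norm_real, Real.norm_of_nonneg h0] at this
    nlinarith
  have e2 : ‖1 - v‖ ≤ ‖1 - μ * v‖ + ‖v‖ * (1 - μ) := by
    have : 1 - v = (1 - μ * v) - v * (1 - μ : ℝ) := by push_cast; ring
    rw [this]
    refine (norm_sub_le _ _).trans ?_
    rw [norm_mul, Complex.norm_real, Real.norm_of_nonneg (sub_nonneg.2 h1.le)]
  have e3 : 1 - μ ≤ 2 * ‖1 - μ * v‖ := by nlinarith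
  nlinarith [norm_nonneg v]

/-- The contribution of one of the orbit sums to the derivative of the complex potential. -/
lemma norm_deriv_dilationSum_increment_mul_le (hf : Differentiable ℂ f) (hpq : p ≠ q)
    {l μ B : ℝ} {v : ℂ} (hl0 : 0 ≤ l) (hl1 : l < 1) (h0 : 0 ≤ μ) (h1 : μ < 1)
    (hv : μ * ‖v‖ ^ 2 ≤ 1) (hv2 : ‖v‖ ≤ 2) (hμv : ‖μ * v‖ < 1)
    (hB : ∀ n : ℕ, ‖deriv f (mobiusInv p q ((l : ℂ) ^ n * (μ * v)))‖ ≤ B) :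
    ‖deriv (dilationSum l (increment f p q)) (μ * v)‖ * (μ * (‖1 - v‖ ^ 2 / |p - q|)) ≤
      25 * B / (1 - l) := by
  have hB0 : 0 ≤ B := (norm_nonneg _).trans (hB 0)
  have hpq' : 0 < |p - q| := abs_pos.2 (sub_ne_zero.2 hpq)
  have hl : 0 < 1 - l := sub_pos.2 hl1
  by_cases hv1 : 1 - v = 0
  · simp only [hv1, norm_zero]
    simp only [ne_eq, OfNat.ofNat_ne_zero, not_false_eq_true, zero_pow, zero_div, mul_zero]
    positivity
  have hv1' : 0 < ‖1 - v‖ := norm_pos_iff.2 hv1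
  have key : ∀ n : ℕ, ‖deriv (increment f p q) ((l : ℂ) ^ n * (μ * v))‖ ≤
      25 * B * (|p - q| / ‖1 - v‖ ^ 2) := by
    intro n
    have hlt : ‖(l : ℂ) ^ n * (μ * v)‖ < 1 := (norm_dilation_le hl0 hl1.le n _).trans_lt hμv
    have hne := one_sub_ne_zero hlt
    have hln0 : 0 ≤ l ^ n := pow_nonneg hl0 n
    have hln1 : l ^ n ≤ 1 := pow_le_one₀ hl0 hl1.le
    rw [(hasDerivAt_increment hf hne).deriv, norm_mul, show 25 * B * (|p - q| / ‖1 - v‖ ^ 2) =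
      B * (25 * (|p - q| / ‖1 - v‖ ^ 2)) by ring]
    refine mul_le_mul (hB n) ?_ (norm_nonneg _) hB0
    -- The comparison is used with lⁿμ in place of μ, which makes it uniform in n; |v| ≤ 2 gives the
    -- factor 1 + 2·2 = 5, whose square is the 25 of the bound.
    have e := norm_one_sub_le (μ := l ^ n * μ) (v := v) (by positivity)
      ((mul_le_of_le_one_left h0 hln1).trans_lt h1) (by
        rw [mul_assoc]; exact (mul_le_of_le_one_left (by positivity) hln1).trans hv)
    have e' : ((l ^ n * μ : ℝ) : ℂ) * v = (l : ℂ) ^ n * (μ * v) := by push_cast; ring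
    rw [e'] at e
    have e2 : ‖1 - v‖ ≤ 5 * ‖1 - (l : ℂ) ^ n * (μ * v)‖ :=
      e.trans (mul_le_mul_of_nonneg_right (by linarith) (norm_nonneg _))
    have hpos : 0 < ‖1 - (l : ℂ) ^ n * (μ * v)‖ := norm_pos_iff.2 hne
    rw [norm_div, norm_pow, ← Complex.ofReal_sub, Complex.norm_real, Real.norm_eq_abs,
      ← mul_div_assoc, div_le_div_iff₀ (by positivity) (by positivity)]
    have e3 : ‖1 - v‖ ^ 2 ≤ 25 * ‖1 - (l : ℂ) ^ n * (μ * v)‖ ^ 2 := by nlinarith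
    nlinarith
  have := norm_deriv_dilationSum_le hl0 hl1 (differentiableOn_increment (p := p) (q := q) hf)
    increment_zero hμv key
  calc _ ≤ 25 * B * (|p - q| / ‖1 - v‖ ^ 2) / (1 - l) * (1 * (‖1 - v‖ ^ 2 / |p - q|)) := by
        gcongr
    _ = _ := by field_simp

end Mobius

end TwoDisks

/-! ### The complex potential built from images. -/

namespace TwoDisks

open ComplexConjugate

/-- The real points `p`, `q` are inverse with respect to the circle with centre `c` and radius
`r`, and `p` is the one inside. -/
structure InversePair (p q c r : ℝ) : Prop where
  pos : 0 < r
  mul_eq : (c - p) * (c - q) = r ^ 2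
  ratio_pos : 0 < (c - p) / (c - q)
  ratio_lt : (c - p) / (c - q) < 1

/-- The squared ratio of the distances to `p` and `q` on the circle with centre `c` with respect
to which `p` and `q` are inverse. -/
def ratio (p q c : ℝ) : ℝ := (c - p) / (c - q)

namespace InversePair

variable {p q c r : ℝ}

lemma sub_ne_zero (h : InversePair p q c r) : c - q ≠ 0 := by
  intro h0
  have := h.ratio_pos
  simp [h0] at this

lemma ne (h : InversePair p q c r) : p ≠ q := by
  rintro rfl
  have := h.ratio_lt
  rw [div_self h.sub_ne_zero] at this
  exact lt_irrefl _ this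

lemma identity (h : InversePair p q c r) (z : ℂ) :
    ‖z - p‖ ^ 2 - ratio p q c * ‖z - q‖ ^ 2 = (1 - ratio p q c) * (‖z - c‖ ^ 2 - r ^ 2) := by
  have := normSq_sub_mul_normSq h.sub_ne_zero h.mul_eq z
  simpa only [Complex.normSq_eq_norm_sq, ratio] using this

lemma ratio_mul_le (h : InversePair p q c r) {z : ℂ} (hz : r ≤ ‖z - c‖) :
    ratio p q c * ‖z - q‖ ^ 2 ≤ ‖z - p‖ ^ 2 := by
  have h1 := h.identity z
  have h2 : 0 < 1 - ratio p q c := by have := h.ratio_lt; rw [ratio]; linarith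
  have h3 : r ^ 2 ≤ ‖z - c‖ ^ 2 := pow_le_pow_left₀ h.pos.le hz 2
  nlinarith [mul_nonneg h2.le (sub_nonneg.2 h3)]

lemma ratio_mul_eq (h : InversePair p q c r) {z : ℂ} (hz : ‖z - c‖ = r) :
    ratio p q c * ‖z - q‖ ^ 2 = ‖z - p‖ ^ 2 := by
  have h1 := h.identity z
  rw [hz] at h1
  linarith

lemma norm_mobiusInv_sub_le (h : InversePair p q c r) {w : ℂ} (hw : ‖w‖ < 1)
    (hwk : ‖w‖ ^ 2 ≤ ratio p q c) : ‖mobiusInv p q w - c‖ ≤ r :=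
  TwoDisks.norm_mobiusInv_sub_le h.pos.le h.sub_ne_zero h.mul_eq h.ratio_lt hw hwk

end InversePair

/-- The complex potential with real part `0` on the first circle and `Re (f b - f a)` on the
second one, obtained from `f` by repeated reflection in the two circles. -/
def potential (f : ℂ → ℂ) (a b k₁ k₂ : ℝ) (z : ℂ) : ℂ :=
  f z - f a
    + dilationSum (k₁ * k₂) (increment f a b) ((k₁ * k₂ : ℝ) * ((z - a) / (z - b)))
    + dilationSum (k₁ * k₂) (increment f b a) ((k₁ * k₂ : ℝ) * ((z - b) / (z - a)))
    - dilationSum (k₁ * k₂) (increment (fun z => conj (f (conj z))) a b) (k₁ * ((z - b) / (z - a)))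
    - dilationSum (k₁ * k₂) (increment (fun z => conj (f (conj z))) b a) (k₂ * ((z - a) / (z - b)))

/-- Words of odd length are antiholomorphic in z. Replacing f by the conjugate of f ∘ conj makes
their contribution holomorphic without changing its real part. -/
lemma differentiable_conj_conj {f : ℂ → ℂ} (hf : Differentiable ℂ f) :
    Differentiable ℂ (fun z => conj (f (conj z))) := fun z => by
  have := (hf (conj z)).hasDerivAt.conj_conj
  rw [Complex.conj_conj] at this
  exact this.differentiableAt

lemma norm_deriv_conj_conj {f : ℂ → ℂ} (hf : Differentiable ℂ f) (z : ℂ) :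
    ‖deriv (fun z => conj (f (conj z))) z‖ = ‖deriv f (conj z)‖ := by
  have := (hf (conj z)).hasDerivAt.conj_conj
  rw [Complex.conj_conj] at this
  have e := this.deriv
  rw [show deriv (fun z => conj (f (conj z))) z = conj (deriv f (conj z)) from e, Complex.norm_conj]

lemma norm_mul_sq_le {k : ℝ} {v : ℂ} (h0 : 0 ≤ k) (h : k * ‖v‖ ^ 2 ≤ 1) :
    ‖(k : ℂ) * v‖ ^ 2 ≤ k := by
  rw [norm_mul, Complex.norm_real, Real.norm_of_nonneg h0, mul_pow, sq k, mul_assoc]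
  exact mul_le_of_le_one_right h0 h

lemma norm_mul_lt_one {k : ℝ} {v : ℂ} (h0 : 0 ≤ k) (h1 : k < 1) (h : k * ‖v‖ ^ 2 ≤ 1) :
    ‖(k : ℂ) * v‖ < 1 := by
  have := norm_mul_sq_le h0 h
  nlinarith [norm_nonneg ((k : ℂ) * v)]

section Potential

variable {f : ℂ → ℂ}

lemma hasDerivAt_dilationSum_mobius (hf : Differentiable ℂ f) (p q : ℝ) {s t l μ : ℝ} {z : ℂ}
    (hl0 : 0 ≤ l) (hl1 : l < 1) (h0 : 0 ≤ μ) (h1 : μ < 1) (hz : z ≠ t)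
    (hv : μ * ‖(z - s) / (z - t)‖ ^ 2 ≤ 1) :
    HasDerivAt (fun z : ℂ => dilationSum l (increment f p q) (μ * ((z - s) / (z - t))))
      (deriv (dilationSum l (increment f p q)) (μ * ((z - s) / (z - t))) *
        (μ * ((s - t) / (z - t) ^ 2))) z :=
  HasDerivAt.comp z (h₂ := dilationSum l (increment f p q))
    (differentiableAt_dilationSum hl0 hl1 (differentiableOn_increment (p := p) (q := q) hf)
      increment_zero (norm_mul_lt_one h0 h1 hv)).hasDerivAt
    ((hasDerivAt_mobius hz).const_mul (μ : ℂ))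

/-- With v = (z - s)/(z - t) one has 1 - v = (s - t)/(z - t), so the chain-rule factor has modulus
μ|1 - v|²/|s - t|, exactly what `norm_deriv_dilationSum_increment_mul_le` absorbs. The condition
with `ratio` places the whole orbit in the disk where |f'| ≤ B. -/
lemma norm_deriv_dilationSum_mobius_le (hf : Differentiable ℂ f) {p q c r s t l μ B : ℝ} {z : ℂ}
    (hpq : InversePair p q c r) (hst : s ≠ t) (habs : |s - t| = |p - q|)
    (hl0 : 0 ≤ l) (hl1 : l < 1) (h0 : 0 ≤ μ) (h1 : μ < 1) (hz : z ≠ t)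
    (hv : μ * ‖(z - s) / (z - t)‖ ^ 2 ≤ 1) (hv2 : ‖(z - s) / (z - t)‖ ≤ 2)
    (hvk : ‖(μ : ℂ) * ((z - s) / (z - t))‖ ^ 2 ≤ ratio p q c)
    (hB : ∀ x : ℂ, ‖x - c‖ ≤ r → ‖deriv f x‖ ≤ B) :
    ‖deriv (dilationSum l (increment f p q)) (μ * ((z - s) / (z - t))) *
        (μ * ((s - t) / (z - t) ^ 2))‖ ≤ 25 * B / (1 - l) := by
  have hlt := norm_mul_lt_one h0 h1 hv
  have h := norm_deriv_dilationSum_increment_mul_le hf hpq.ne hl0 hl1 h0 h1 hv hv2 hlt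
    (B := B) fun n => hB _ <| by
      have hle := norm_dilation_le hl0 hl1.le n (μ * ((z - s) / (z - t)))
      exact hpq.norm_mobiusInv_sub_le (hle.trans_lt hlt)
        ((pow_le_pow_left₀ (norm_nonneg _) hle 2).trans hvk)
  refine le_of_eq_of_le ?_ h
  have hzt : z - t ≠ 0 := sub_ne_zero.2 hz
  have e : 1 - (z - s) / (z - t) = ((s - t : ℝ) : ℂ) / (z - t) := by
    push_cast; field_simp; ring
  have hst' : 0 < |s - t| := abs_pos.2 (sub_ne_zero.2 hst)
  rw [norm_mul, norm_mul, e, norm_div, norm_div, norm_pow, Complex.norm_real, Complex.norm_real,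
    ← Complex.ofReal_sub, Complex.norm_real, Real.norm_of_nonneg h0, Real.norm_eq_abs, ← habs]
  congr 2
  have : ‖z - t‖ ≠ 0 := norm_ne_zero_iff.2 hzt
  field_simp

lemma tendsto_mobius (p q : ℝ) :
    Tendsto (fun z : ℂ => (z - p) / (z - q)) (Bornology.cobounded ℂ) (𝓝 1) := by
  have h1 : Tendsto (fun z : ℂ => z - q) (Bornology.cobounded ℂ) (Bornology.cobounded ℂ) :=
    tendsto_sub_const_cobounded _
  have h2 : Tendsto (fun z : ℂ => 1 + ((q : ℂ) - p) * (z - q)⁻¹) (Bornology.cobounded ℂ)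
      (𝓝 (1 + ((q : ℂ) - p) * 0)) :=
    ((tendsto_inv₀_cobounded.comp h1).const_mul _).const_add _
  rw [mul_zero, add_zero] at h2
  refine h2.congr' ?_
  filter_upwards [Bornology.eventually_ne_cobounded (q : ℂ)] with z hz
  have := sub_ne_zero.2 hz
  field_simp
  ring

lemma tendsto_dilationSum_mobius (hf : Differentiable ℂ f) (p q s t : ℝ) {l μ : ℝ}
    (hl0 : 0 ≤ l) (hl1 : l < 1) (h0 : 0 ≤ μ) (h1 : μ < 1) :
    Tendsto (fun z : ℂ => dilationSum l (increment f p q) (μ * ((z - s) / (z - t))))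
      (Bornology.cobounded ℂ) (𝓝 (dilationSum l (increment f p q) (μ * 1))) := by
  refine (differentiableAt_dilationSum hl0 hl1 (differentiableOn_increment (p := p) (q := q) hf)
    increment_zero ?_).continuousAt.tendsto.comp ((tendsto_mobius s t).const_mul (μ : ℂ))
  simpa [abs_of_nonneg h0] using h1

/-- The data of two disjoint disks with common inverse points `a`, `b`. -/
structure LimitPoints (a b c₁ r₁ c₂ r₂ : ℝ) : Prop where
  left : InversePair a b c₁ r₁
  right : InversePair b a c₂ r₂

variable {a b c₁ r₁ c₂ r₂ : ℝ}

/-- The multiplier of the composition of the two reflections. -/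
def multiplier (a b c₁ c₂ : ℝ) : ℝ := ratio a b c₁ * ratio b a c₂

namespace LimitPoints

lemma multiplier_pos (h : LimitPoints a b c₁ r₁ c₂ r₂) : 0 < multiplier a b c₁ c₂ :=
  mul_pos h.left.ratio_pos h.right.ratio_pos

lemma multiplier_lt_one (h : LimitPoints a b c₁ r₁ c₂ r₂) : multiplier a b c₁ c₂ < 1 :=
  mul_lt_one_of_nonneg_of_lt_one_left h.left.ratio_pos.le h.left.ratio_lt h.right.ratio_lt.le

lemma ne_right (h : LimitPoints a b c₁ r₁ c₂ r₂) {z : ℂ} (hz : r₂ ≤ ‖z - c₂‖) : z ≠ b := by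
  rintro rfl
  have h1 := h.right.ratio_mul_le hz
  have h2 : ‖(b : ℂ) - a‖ ≠ 0 := by
    rw [norm_ne_zero_iff, ← Complex.ofReal_sub, Complex.ofReal_ne_zero, sub_ne_zero]
    exact h.left.ne.symm
  have h3 : 0 < ratio b a c₂ * ‖(b : ℂ) - a‖ ^ 2 := mul_pos h.right.ratio_pos (by positivity)
  simp at h1 h3
  linarith

lemma symm (h : LimitPoints a b c₁ r₁ c₂ r₂) : LimitPoints b a c₂ r₂ c₁ r₁ := ⟨h.right, h.left⟩

lemma ne_left (h : LimitPoints a b c₁ r₁ c₂ r₂) {z : ℂ} (hz : r₁ ≤ ‖z - c₁‖) : z ≠ a :=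
  h.symm.ne_right hz

/-- This is the Apollonius inequality outside the first disk, in the form that puts the arguments of
the dilation sums in the open unit disk. -/
lemma ratio_mul_sq_le (h : LimitPoints a b c₁ r₁ c₂ r₂) {z : ℂ} (hz₁ : r₁ ≤ ‖z - c₁‖) :
    ratio a b c₁ * ‖(z - b) / (z - a)‖ ^ 2 ≤ 1 := by
  have hpos : 0 < ‖z - a‖ := norm_pos_iff.2 (sub_ne_zero.2 (h.ne_left hz₁))
  rw [norm_div, div_pow, ← mul_div_assoc, div_le_one (by positivity)]
  exact h.left.ratio_mul_le hz₁

lemma multiplier_mul_sq_le (h : LimitPoints a b c₁ r₁ c₂ r₂) {z : ℂ} (hz₁ : r₁ ≤ ‖z - c₁‖) :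
    multiplier a b c₁ c₂ * ‖(z - b) / (z - a)‖ ^ 2 ≤ ratio b a c₂ := by
  rw [multiplier, mul_right_comm]
  exact mul_le_of_le_one_left h.right.ratio_pos.le (h.ratio_mul_sq_le hz₁)

lemma multiplier_comm : multiplier b a c₂ c₁ = multiplier a b c₁ c₂ := mul_comm _ _

lemma norm_multiplier_mul_sq_le (h : LimitPoints a b c₁ r₁ c₂ r₂) {z : ℂ}
    (hz₁ : r₁ ≤ ‖z - c₁‖) :
    ‖(multiplier a b c₁ c₂ : ℂ) * ((z - b) / (z - a))‖ ^ 2 ≤ ratio b a c₂ := by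
  have h1 := h.multiplier_mul_sq_le hz₁
  exact (norm_mul_sq_le h.multiplier_pos.le (h1.trans h.right.ratio_lt.le)).trans
    (mul_le_of_le_one_left h.right.ratio_pos.le h.left.ratio_lt.le)

/-- The derivative of the complex potential, and its size. -/
lemma hasDerivAt_potential (h : LimitPoints a b c₁ r₁ c₂ r₂) (hf : Differentiable ℂ f) {z : ℂ}
    (hz₁ : r₁ ≤ ‖z - c₁‖) (hz₂ : r₂ ≤ ‖z - c₂‖) :
    ∃ D : ℂ, HasDerivAt (potential f a b (ratio a b c₁) (ratio b a c₂)) D z ∧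
      ∀ B : ℝ, ‖(z - a) / (z - b)‖ ≤ 2 → ‖(z - b) / (z - a)‖ ≤ 2 → ‖deriv f z‖ ≤ B →
        (∀ x : ℂ, ‖x - c₁‖ ≤ r₁ → ‖deriv f x‖ ≤ B) →
        (∀ x : ℂ, ‖x - c₂‖ ≤ r₂ → ‖deriv f x‖ ≤ B) →
        ‖D‖ ≤ B + 4 * (25 * B / (1 - multiplier a b c₁ c₂)) := by
  have hl0 := h.multiplier_pos.le
  have hl1 := h.multiplier_lt_one
  have hk₁ := h.left.ratio_pos.le
  have hk₂ := h.right.ratio_pos.le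
  have hk₁' := h.left.ratio_lt
  have hk₂' := h.right.ratio_lt
  have hf' := differentiable_conj_conj hf
  have m1 := (h.multiplier_mul_sq_le hz₁).trans hk₂'.le
  have m2 := (h.symm.multiplier_mul_sq_le hz₂).trans hk₁'.le
  have n1 := h.norm_multiplier_mul_sq_le hz₁
  have n2 := h.symm.norm_multiplier_mul_sq_le hz₂
  rw [multiplier_comm] at m2 n2
  have q1 := h.ratio_mul_sq_le hz₁
  have q2 := h.symm.ratio_mul_sq_le hz₂
  have hza := h.ne_left hz₁
  have hzb := h.ne_right hz₂
  have d1 := hasDerivAt_dilationSum_mobius hf a b hl0 hl1 hl0 hl1 hzb m2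
  have d2 := hasDerivAt_dilationSum_mobius hf b a hl0 hl1 hl0 hl1 hza m1
  have d3 := hasDerivAt_dilationSum_mobius hf' a b hl0 hl1 hk₁ hk₁' hza q1
  have d4 := hasDerivAt_dilationSum_mobius hf' b a hl0 hl1 hk₂ hk₂' hzb q2
  refine ⟨_, (((((hf z).hasDerivAt.sub_const (f a)).add d1).add d2).sub d3).sub d4, ?_⟩
  intro B hv hv' hBz hB₁ hB₂
  have hB₁' : ∀ x : ℂ, ‖x - c₁‖ ≤ r₁ → ‖deriv (fun z => conj (f (conj z))) x‖ ≤ B :=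
    fun x hx => by
      rw [norm_deriv_conj_conj hf]
      exact hB₁ _ (by rwa [← Complex.norm_conj, map_sub, Complex.conj_conj, Complex.conj_ofReal])
  have hB₂' : ∀ x : ℂ, ‖x - c₂‖ ≤ r₂ → ‖deriv (fun z => conj (f (conj z))) x‖ ≤ B :=
    fun x hx => by
      rw [norm_deriv_conj_conj hf]
      exact hB₂ _ (by rwa [← Complex.norm_conj, map_sub, Complex.conj_conj, Complex.conj_ofReal])
  have e1 := norm_deriv_dilationSum_mobius_le hf h.left h.left.ne rfl hl0 hl1 hl0 hl1 hzb m2 hv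
    n2 hB₁
  have e2 := norm_deriv_dilationSum_mobius_le hf h.right h.right.ne rfl hl0 hl1 hl0 hl1 hza m1 hv'
    n1 hB₂
  have e3 := norm_deriv_dilationSum_mobius_le hf' h.left h.right.ne (abs_sub_comm _ _) hl0 hl1
    hk₁ hk₁' hza q1 hv' (norm_mul_sq_le hk₁ q1) hB₁'
  have e4 := norm_deriv_dilationSum_mobius_le hf' h.right h.left.ne (abs_sub_comm _ _) hl0 hl1
    hk₂ hk₂' hzb q2 hv (norm_mul_sq_le hk₂ q2) hB₂'
  refine (norm_sub_le _ _).trans ?_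
  refine (add_le_add (norm_sub_le _ _) le_rfl).trans ?_
  refine (add_le_add (add_le_add (norm_add_le _ _) le_rfl) le_rfl).trans ?_
  refine (add_le_add (add_le_add (add_le_add (norm_add_le _ _) le_rfl) le_rfl) le_rfl).trans ?_
  linarith

lemma ratio_mul_div_eq_conj (h : LimitPoints a b c₁ r₁ c₂ r₂) {z : ℂ} (hz₁ : ‖z - c₁‖ = r₁)
    (hzb : z ≠ b) : (ratio a b c₁ : ℂ) * ((z - b) / (z - a)) = conj ((z - a) / (z - b)) := by
  have h1 := h.left.ratio_mul_eq hz₁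
  have hza := sub_ne_zero.2 (h.ne_left hz₁.ge)
  have hzb' := sub_ne_zero.2 hzb
  rw [← Complex.normSq_eq_norm_sq, ← Complex.normSq_eq_norm_sq] at h1
  have h2 : (ratio a b c₁ : ℂ) * ((z - b) * conj (z - b)) = (z - a) * conj (z - a) := by
    rw [Complex.mul_conj, Complex.mul_conj]
    exact_mod_cast h1
  have hc : conj (z - b) ≠ 0 := (map_ne_zero _).2 hzb'
  rw [map_div₀, eq_div_iff hc, ← mul_div_assoc, div_mul_eq_mul_div, div_eq_iff hza]
  linear_combination h2

lemma norm_lt_one (h : LimitPoints a b c₁ r₁ c₂ r₂) {z : ℂ} (hz₁ : ‖z - c₁‖ = r₁)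
    (hzb : z ≠ b) : ‖(z - a) / (z - b)‖ < 1 := by
  have h1 := h.left.ratio_mul_eq hz₁
  have hpos : 0 < ‖z - b‖ := norm_pos_iff.2 (sub_ne_zero.2 hzb)
  have := h.left.ratio_lt
  rw [norm_div, div_lt_one hpos]
  refine lt_of_pow_lt_pow_left₀ 2 hpos.le ?_
  rw [← h1]
  exact mul_lt_of_lt_one_left (by positivity) this

/-- The real part of the potential vanishes on the first circle. -/
lemma potential_eq_left (h : LimitPoints a b c₁ r₁ c₂ r₂) (hf : Differentiable ℂ f) {z : ℂ}
    (hz₁ : ‖z - c₁‖ = r₁) (hzb : z ≠ b) :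
    (potential f a b (ratio a b c₁) (ratio b a c₂) z).re = 0 := by
  have hl0 := h.multiplier_pos.le
  have hl1 := h.multiplier_lt_one
  -- A point of the circle is its own reflection: k₁/w = conj w. Hence the first odd sum is the
  -- conjugate of the full even sum at w, split by `dilationSum_eq_add` into f z - f a and the rest,
  -- and the second odd sum is the conjugate of the second even one. Real parts cancel.
  have e1 := h.ratio_mul_div_eq_conj hz₁ hzb
  have e2 : ((ratio a b c₁ * ratio b a c₂ : ℝ) : ℂ) * ((z - b) / (z - a)) =
      ratio b a c₂ * conj ((z - a) / (z - b)) := by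
    rw [← e1]; push_cast; ring
  have e3 := dilationSum_eq_add hl0 hl1 (differentiableOn_increment (p := a) (q := b) hf)
    increment_zero (h.norm_lt_one hz₁ hzb)
  rw [increment_mobius h.left.ne hzb] at e3
  have e4 : ∀ p q : ℝ, ∀ w, dilationSum (ratio a b c₁ * ratio b a c₂)
      (increment (fun z => conj (f (conj z))) p q) w =
      conj (dilationSum (ratio a b c₁ * ratio b a c₂) (increment f p q) (conj w)) := by
    intro p q w
    rw [← dilationSum_conj]
    congr 1
    ext v
    exact increment_conj v
  rw [potential, e2, e4, e4, e1, Complex.conj_conj, map_mul, Complex.conj_ofReal]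
  have e5 := congrArg Complex.re e3
  rw [multiplier] at e5
  simp only [Complex.sub_re, Complex.add_re, Complex.conj_re] at e5 ⊢
  linarith

/-- The four sums are symmetric under the exchange of the disks; only the base value f a is not. The
boundary value on the second circle then follows from the first. -/
lemma potential_swap (k₁ k₂ : ℝ) (z : ℂ) :
    potential f a b k₁ k₂ z = potential f b a k₂ k₁ z + (f b - f a) := by
  rw [potential, potential, mul_comm k₂ k₁]
  ring

lemma potential_eq_right (h : LimitPoints a b c₁ r₁ c₂ r₂) (hf : Differentiable ℂ f) {z : ℂ}
    (hz₂ : ‖z - c₂‖ = r₂) (hza : z ≠ a) :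
    (potential f a b (ratio a b c₁) (ratio b a c₂) z).re = (f b).re - (f a).re := by
  rw [potential_swap, Complex.add_re, h.symm.potential_eq_left hf hz₂ hza, zero_add,
    Complex.sub_re]

/-- At infinity w tends to 1, so each dilation sum converges to its value at an interior point of
the unit disk. -/
lemma potential_sub_isBigO (h : LimitPoints a b c₁ r₁ c₂ r₂) (hf : Differentiable ℂ f) :
    (fun z => potential f a b (ratio a b c₁) (ratio b a c₂) z - f z)
      =O[Bornology.cobounded ℂ] fun _ => (1 : ℝ) := by
  have hl0 := h.multiplier_pos.le
  have hl1 := h.multiplier_lt_one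
  have hf' := differentiable_conj_conj hf
  have d1 := tendsto_dilationSum_mobius hf a b a b hl0 hl1 hl0 hl1
  have d2 := tendsto_dilationSum_mobius hf b a b a hl0 hl1 hl0 hl1
  have d3 := tendsto_dilationSum_mobius hf' a b b a hl0 hl1 h.left.ratio_pos.le h.left.ratio_lt
  have d4 := tendsto_dilationSum_mobius hf' b a a b hl0 hl1 h.right.ratio_pos.le h.right.ratio_lt
  refine Tendsto.isBigO_one ℝ (Tendsto.congr ?_ ((((d1.add d2).sub d3).sub d4).sub_const (f a)))
  intro z
  rw [potential]
  simp only [multiplier, ratio]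
  ring

end LimitPoints

end Potential

end TwoDisks

/-! ### Maximum principles, in bounded sets and in the exterior of two disks. -/

namespace TwoDisks

open InnerProductSpace

/-- Locally f = Re F with F analytic, and |exp F| = exp f reduces the claim to the maximum modulus
principle. -/
lemma eventually_eq_of_isLocalMax_of_harmonicAt {f : ℂ → ℝ} {z : ℂ} (hf : HarmonicAt f z)
    (hmax : IsLocalMax f z) : ∀ᶠ w in 𝓝 z, f w = f z := by
  obtain ⟨R, hR, hball⟩ := Metric.eventually_nhds_iff_ball.1 hf.eventually
  obtain ⟨F, hF, hre⟩ := HarmonicOnNhd.exists_analyticOnNhd_ball_re_eq (f := f) (z := z) (R := R)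
    hball
  have hzR := mem_ball_self (x := z) hR
  have hnorm : ∀ w ∈ ball z R, ‖Complex.exp (F w)‖ = Real.exp (f w) := fun w hw => by
    rw [Complex.norm_exp, ← hre hw]
  have hd : ∀ᶠ w in 𝓝 z, DifferentiableAt ℂ (fun w => Complex.exp (F w)) w := by
    filter_upwards [ball_mem_nhds z hR] with w hw
    exact (hF w hw).differentiableAt.cexp
  have hm : IsLocalMax (norm ∘ fun w => Complex.exp (F w)) z := by
    filter_upwards [ball_mem_nhds z hR, hmax] with w hw hle
    simp only [Function.comp_apply, hnorm w hw, hnorm z hzR]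
    exact Real.exp_le_exp.2 hle
  filter_upwards [Complex.eventually_eq_of_isLocalMax_norm hd hm, ball_mem_nhds z hR] with w h1 hw
  have := congrArg norm h1
  rw [hnorm w hw, hnorm z hzR] at this
  exact Real.exp_injective this

/-- The weak maximum principle for harmonic functions on a bounded open set of the plane. -/
theorem harmonic_nonpos_of_boundary {U : Set ℂ} (hU : IsOpen U) (hb : Bornology.IsBounded U)
    {f : ℂ → ℝ} (hf : HarmonicOnNhd f U) (hc : ContinuousOn f (closure U))
    (hbd : ∀ z ∈ closure U, z ∉ U → f z ≤ 0) {z : ℂ} (hz : z ∈ closure U) : f z ≤ 0 := by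
  have hcpt : IsCompact (closure U) := hb.isCompact_closure
  obtain ⟨x, hx, hmax⟩ := hcpt.exists_isMaxOn ⟨z, hz⟩ hc
  refine (hmax hz).trans ?_
  have hK : IsCompact (closure U ∩ f ⁻¹' {f x}) :=
    hcpt.of_isClosed_subset (hc.preimage_isClosed_of_isClosed isClosed_closure isClosed_singleton)
      inter_subset_left
  -- Among the maximum points, y has the largest real part. Were y interior, f would be constant
  -- near y and a small shift to the right would give a maximum point with larger real part.
  obtain ⟨y, ⟨hy, hyx⟩, hymax⟩ := hK.exists_isMaxOn ⟨x, hx, rfl⟩ Complex.continuous_re.continuousOn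
  have hyx' : f y = f x := hyx
  rw [← hyx']
  by_cases hyU : y ∈ U
  swap
  · exact hbd y hy hyU
  exfalso
  have hloc : IsLocalMax f y := by
    filter_upwards [hU.mem_nhds hyU] with w hw
    rw [hyx']
    exact hmax (subset_closure hw)
  have hev := (eventually_eq_of_isLocalMax_of_harmonicAt (hf y hyU) hloc).and (hU.mem_nhds hyU)
  have ht : Tendsto (fun t : ℝ => y + (t : ℂ)) (𝓝[>] 0) (𝓝 y) := by
    have : Tendsto (fun t : ℝ => y + (t : ℂ)) (𝓝 0) (𝓝 (y + ((0 : ℝ) : ℂ))) :=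
      (Continuous.tendsto (by fun_prop) 0)
    rw [Complex.ofReal_zero, add_zero] at this
    exact this.mono_left nhdsWithin_le_nhds
  obtain ⟨t, ⟨h1, h2⟩, ht0⟩ := ((ht.eventually hev).and self_mem_nhdsWithin).exists
  have := hymax (show y + (t : ℂ) ∈ closure U ∩ f ⁻¹' {f x} from
    ⟨subset_closure h2, by simp [h1, hyx']⟩)
  simp only [mem_ofPred_eq, Complex.add_re, Complex.ofReal_re] at this
  have ht0' : 0 < t := ht0
  linarith

/-- The open exterior of two disks. -/
def openExterior (c₁ c₂ : ℂ) (r₁ r₂ : ℝ) : Set ℂ := {z | r₁ < ‖z - c₁‖ ∧ r₂ < ‖z - c₂‖}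

/-- The closed exterior of two disks. -/
def closedExterior (c₁ c₂ : ℂ) (r₁ r₂ : ℝ) : Set ℂ := {z | r₁ ≤ ‖z - c₁‖ ∧ r₂ ≤ ‖z - c₂‖}

section Exterior

variable {c₁ c₂ : ℂ} {r₁ r₂ : ℝ}

lemma isOpen_openExterior : IsOpen (openExterior c₁ c₂ r₁ r₂) := by
  have h : ∀ (c : ℂ) (r : ℝ), IsOpen {z : ℂ | r < ‖z - c‖} := fun c r =>
    isOpen_lt (by fun_prop) (by fun_prop)
  exact (h c₁ r₁).inter (h c₂ r₂)

lemma isClosed_closedExterior : IsClosed (closedExterior c₁ c₂ r₁ r₂) := by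
  have h : ∀ (c : ℂ) (r : ℝ), IsClosed {z : ℂ | r ≤ ‖z - c‖} := fun c r =>
    isClosed_le (by fun_prop) (by fun_prop)
  exact (h c₁ r₁).inter (h c₂ r₂)

lemma openExterior_subset : openExterior c₁ c₂ r₁ r₂ ⊆ closedExterior c₁ c₂ r₁ r₂ :=
  fun _ hz => ⟨hz.1.le, hz.2.le⟩

/-- The barrier δ log(|x - c₁|/r₁) is harmonic, nonnegative on the exterior, and exceeds the bound
of W on large circles. The bounded principle gives W ≤ δL for every δ > 0, and δ is free. -/
lemma harmonic_exterior_nonpos (hr₁ : 0 < r₁) {W : ℂ → ℝ}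
    (hW : HarmonicOnNhd W (openExterior c₁ c₂ r₁ r₂))
    (hc : ContinuousOn W (closedExterior c₁ c₂ r₁ r₂))
    (hbd : ∀ z ∈ closedExterior c₁ c₂ r₁ r₂, z ∉ openExterior c₁ c₂ r₁ r₂ → W z ≤ 0)
    (hO : W =O[Bornology.cobounded ℂ] fun _ => (1 : ℝ))
    {z : ℂ} (hz : z ∈ closedExterior c₁ c₂ r₁ r₂) : W z ≤ 0 := by
  set L : ℂ → ℝ := fun x => Real.log (‖x - c₁‖ / r₁) with hL
  have hL0 : ∀ x ∈ closedExterior c₁ c₂ r₁ r₂, 0 ≤ L x := fun x hx =>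
    Real.log_nonneg ((one_le_div hr₁).2 hx.1)
  have hne : ∀ x ∈ closedExterior c₁ c₂ r₁ r₂, ‖x - c₁‖ ≠ 0 := fun x hx =>
    (hr₁.trans_le hx.1).ne'
  have key : ∀ δ : ℝ, 0 < δ → W z ≤ δ * L z := by
    intro δ hδ
    obtain ⟨B, hB⟩ := hO.bound
    have hBb : Bornology.IsBounded {x | ‖W x‖ ≤ B * ‖(1 : ℝ)‖}ᶜ := by
      rw [Bornology.isBounded_def, compl_compl]
      exact hB
    obtain ⟨R₀, hR₀⟩ := hBb.subset_ball c₁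
    have hlog : Tendsto (fun R : ℝ => δ * Real.log (R / r₁)) atTop atTop :=
      (Real.tendsto_log_atTop.comp (tendsto_id.atTop_div_const hr₁)).const_mul_atTop hδ
    obtain ⟨R, hRB, hRz, hRR⟩ := ((hlog.eventually_ge_atTop B).and
      ((eventually_gt_atTop ‖z - c₁‖).and (eventually_ge_atTop R₀))).exists
    set U := openExterior c₁ c₂ r₁ r₂ ∩ ball c₁ R with hUdef
    have hUo : IsOpen U := isOpen_openExterior.inter isOpen_ball
    have hUb : Bornology.IsBounded U := isBounded_ball.subset inter_subset_right
    have hcl : closure U ⊆ closedExterior c₁ c₂ r₁ r₂ ∩ closedBall c₁ R :=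
      closure_minimal (inter_subset_inter openExterior_subset ball_subset_closedBall)
        (isClosed_closedExterior.inter isClosed_closedBall)
    have hharm : HarmonicOnNhd (W - δ • L) U := by
      intro x hx
      refine (hW x hx.1).sub (HarmonicAt.const_smul ?_)
      have hx0 := hne x (openExterior_subset hx.1)
      have h1 : HarmonicAt (fun x : ℂ => Real.log ‖(x - c₁) / r₁‖) x :=
        AnalyticAt.harmonicAt_log_norm (f := fun x : ℂ => (x - c₁) / r₁) (by fun_prop)
          (div_ne_zero (norm_ne_zero_iff.1 hx0) (by exact_mod_cast hr₁.ne'))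
      convert h1 using 2 with y
      simp [hL, abs_of_pos hr₁]
    have hcont : ContinuousOn (W - δ • L) (closure U) := by
      refine (hc.mono fun x hx => (hcl hx).1).sub (ContinuousOn.const_smul ?_ δ)
      refine ContinuousOn.log (by fun_prop) fun x hx => ?_
      exact div_ne_zero (hne x (hcl hx).1) hr₁.ne'
    have hbdU : ∀ x ∈ closure U, x ∉ U → (W - δ • L) x ≤ 0 := by
      intro x hx hxU
      have hxF := (hcl hx).1
      have hxR : ‖x - c₁‖ ≤ R := by simpa [dist_eq_norm] using (hcl hx).2
      simp only [Pi.sub_apply, Pi.smul_apply, smul_eq_mul, sub_nonpos]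
      by_cases hxo : x ∈ openExterior c₁ c₂ r₁ r₂
      · have hxR' : ‖x - c₁‖ = R := by
          refine le_antisymm hxR (not_lt.1 fun hlt => hxU ⟨hxo, ?_⟩)
          simpa [dist_eq_norm] using hlt
        have hWB : ‖W x‖ ≤ B := by
          by_contra hnot
          have : x ∈ ball c₁ R₀ := hR₀ (by simpa using hnot)
          rw [mem_ball, dist_eq_norm] at this
          linarith
        calc W x ≤ B := (Real.le_norm_self _).trans hWB
          _ ≤ δ * L x := by rw [hL]; simp only [hxR']; exact hRB
      · exact (hbd x hxF hxo).trans (mul_nonneg hδ.le (hL0 x hxF))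
    by_cases hzo : z ∈ openExterior c₁ c₂ r₁ r₂
    · have hzU : z ∈ U := ⟨hzo, by simpa [dist_eq_norm] using hRz⟩
      have := harmonic_nonpos_of_boundary hUo hUb hharm hcont hbdU (subset_closure hzU)
      simpa only [Pi.sub_apply, Pi.smul_apply, smul_eq_mul, sub_nonpos] using this
    · exact (hbd z hz hzo).trans (mul_nonneg hδ.le (hL0 z hz))
  by_contra! hpos
  have hz0 := hL0 z hz
  -- This δ makes δ L(z) < W(z) when W(z) > 0.
  have := key (W z / (2 * (L z + 1))) (by positivity)
  rw [div_mul_eq_mul_div, le_div_iff₀ (by positivity)] at this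
  nlinarith

/-- A bounded harmonic function in the exterior of two disks that vanishes on the boundary is
zero. -/
theorem harmonic_exterior_eq_zero (hr₁ : 0 < r₁) {W : ℂ → ℝ}
    (hW : HarmonicOnNhd W (openExterior c₁ c₂ r₁ r₂))
    (hc : ContinuousOn W (closedExterior c₁ c₂ r₁ r₂))
    (hbd : ∀ z ∈ closedExterior c₁ c₂ r₁ r₂, z ∉ openExterior c₁ c₂ r₁ r₂ → W z = 0)
    (hO : W =O[Bornology.cobounded ℂ] fun _ => (1 : ℝ))
    {z : ℂ} (hz : z ∈ closedExterior c₁ c₂ r₁ r₂) : W z = 0 := by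
  refine le_antisymm (harmonic_exterior_nonpos hr₁ hW hc (fun x h1 h2 => (hbd x h1 h2).le) hO hz) ?_
  have := harmonic_exterior_nonpos (W := -W) hr₁ (fun x hx => (hW x hx).neg) hc.neg
    (fun x h1 h2 => by simp [hbd x h1 h2]) hO.neg_left hz
  simpa using this

end Exterior

end TwoDisks

/-! ### Passage between the Euclidean plane and ℂ. -/

namespace TwoDisks

open InnerProductSpace ComplexConjugate Laplacian

/-- The identification of the complex plane with the Euclidean plane. -/
def planeIso : ℂ ≃ₗᵢ[ℝ] Plane := Complex.orthonormalBasisOneI.repr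

lemma planeIso_apply (z : ℂ) : planeIso z = !₂[z.re, z.im] := by
  ext i
  fin_cases i <;> simp [planeIso, Complex.orthonormalBasisOneI_repr_apply]

lemma planeIso_ofReal (t : ℝ) : planeIso t = !₂[t, 0] := by simp [planeIso_apply]

/-- The Laplacian may be computed in any orthonormal basis, and the isometry carries one basis to
another. -/
lemma harmonicAt_comp_planeIso {u : Plane → ℝ} {z : ℂ} (hu : HarmonicAt u (planeIso z)) :
    HarmonicAt (u ∘ planeIso) z := by
  refine ⟨hu.1.comp z planeIso.contDiff.contDiffAt, ?_⟩
  have hlap : ∀ w, (Δ (u ∘ planeIso)) w = (Δ u) (planeIso w) := by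
    intro w
    rw [laplacian_eq_iteratedFDeriv_orthonormalBasis _ Complex.orthonormalBasisOneI,
      laplacian_eq_iteratedFDeriv_orthonormalBasis _
        (Complex.orthonormalBasisOneI.map planeIso)]
    refine Finset.sum_congr rfl fun i _ => ?_
    have h2 : iteratedFDeriv ℝ 2 (u ∘ planeIso) w =
        (iteratedFDeriv ℝ 2 u (planeIso w)).compContinuousLinearMap
          fun _ => (planeIso.toContinuousLinearEquiv : ℂ →L[ℝ] Plane) := by
      have := planeIso.toContinuousLinearEquiv.iteratedFDerivWithin_comp_right u uniqueDiffOn_univ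
        (mem_univ (planeIso w)) 2
      rwa [preimage_univ, iteratedFDerivWithin_univ, iteratedFDerivWithin_univ] at this
    rw [h2]
    simp only [ContinuousMultilinearMap.compContinuousLinearMap_apply]
    congr 1
    ext j
    fin_cases j <;> simp
  have hev := planeIso.continuous.continuousAt.eventually hu.2
  filter_upwards [hev] with w hw
  rw [hlap w, hw]
  rfl

lemma hasGradientAt_of_re {u : Plane → ℝ} {Ψ : ℂ → ℂ} {d z : ℂ} (hΨ : HasDerivAt Ψ d z)
    (h : ∀ᶠ w in 𝓝 z, u (planeIso w) = (Ψ w).re) :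
    HasGradientAt u (planeIso (conj d)) (planeIso z) := by
  have h1 : HasFDerivAt (fun w => (Ψ w).re) (Complex.reCLM.comp
      ((ContinuousLinearMap.toSpanSingleton ℂ d).restrictScalars ℝ)) z :=
    Complex.reCLM.hasFDerivAt.comp z (hΨ.hasFDerivAt.restrictScalars ℝ)
  have h2 : HasFDerivAt (planeIso.symm : Plane → ℂ)
      (planeIso.symm.toContinuousLinearEquiv : Plane →L[ℝ] ℂ) (planeIso z) :=
    planeIso.symm.toContinuousLinearEquiv.hasFDerivAt
  have h3 := HasFDerivAt.comp (planeIso z)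
    (by rw [planeIso.symm_apply_apply]; exact h1) h2
  have h4 : (fun w => (Ψ w).re) ∘ planeIso.symm =ᶠ[𝓝 (planeIso z)] u := by
    have ht : Tendsto planeIso.symm (𝓝 (planeIso z)) (𝓝 z) := by
      have := planeIso.symm.continuous.tendsto (planeIso z)
      rwa [planeIso.symm_apply_apply] at this
    filter_upwards [ht.eventually h] with x hx
    simpa using hx.symm
  rw [hasGradientAt_iff_hasFDerivAt]
  refine (h3.congr_of_eventuallyEq h4.symm).congr_fderiv ?_
  ext x
  obtain ⟨y, rfl⟩ := planeIso.surjective x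
  rw [toDual_apply_apply, planeIso.inner_map_map, Complex.inner]
  simp [mul_comm]

lemma center₁_eq (r₁ ε : ℝ) : center₁ r₁ ε = planeIso ((r₁ + ε : ℝ) : ℂ) :=
  (planeIso_ofReal _).symm

lemma center₂_eq (r₂ ε : ℝ) : center₂ r₂ ε = planeIso ((-r₂ - ε : ℝ) : ℂ) :=
  (planeIso_ofReal _).symm

lemma dist_planeIso (z w : ℂ) : dist (planeIso z) (planeIso w) = ‖z - w‖ := by
  rw [planeIso.dist_map, dist_eq_norm]

lemma unitVec_eq (θ : ℝ) : unitVec θ = planeIso (Complex.exp (θ * Complex.I)) := by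
  rw [planeIso_apply, Complex.exp_ofReal_mul_I_re, Complex.exp_ofReal_mul_I_im, unitVec]

/-- The closed exterior of the two disks `D₁`, `D₂`. -/
abbrev closedExt (r₁ r₂ ε : ℝ) : Set ℂ :=
  closedExterior ((r₁ + ε : ℝ) : ℂ) ((-r₂ - ε : ℝ) : ℂ) r₁ r₂

/-- The open exterior of the two disks `D₁`, `D₂`. -/
abbrev openExt (r₁ r₂ ε : ℝ) : Set ℂ :=
  openExterior ((r₁ + ε : ℝ) : ℂ) ((-r₂ - ε : ℝ) : ℂ) r₁ r₂

lemma planeIso_mem_compl_disks {r₁ r₂ ε : ℝ} {z : ℂ} :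
    planeIso z ∈ (disk₁ r₁ ε ∪ disk₂ r₂ ε)ᶜ ↔ z ∈ closedExt r₁ r₂ ε := by
  rw [disk₁, disk₂, center₁_eq, center₂_eq]
  simp only [mem_compl_iff, mem_union, mem_ball, dist_planeIso, not_or, not_lt]
  rfl

lemma planeIso_mem_compl_closure {r₁ r₂ ε : ℝ} (hr₁ : 0 < r₁) (hr₂ : 0 < r₂) {z : ℂ} :
    planeIso z ∈ (closure (disk₁ r₁ ε ∪ disk₂ r₂ ε))ᶜ ↔ z ∈ openExt r₁ r₂ ε := by
  rw [disk₁, disk₂, center₁_eq, center₂_eq, closure_union, closure_ball _ hr₁.ne',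
    closure_ball _ hr₂.ne']
  simp only [mem_compl_iff, mem_union, mem_closedBall, dist_planeIso, not_or, not_le]
  rfl

/-- The flux of the gradient field `conj D` is the imaginary part of a contour integral. -/
lemma circleFlux_eq {G : Plane → Plane} {D : ℂ → ℂ} {c r : ℝ}
    (hr : 0 ≤ r) (hG : ∀ z : ℂ, ‖z - c‖ = r → G (planeIso z) = planeIso (conj (D z)))
    (hD : CircleIntegrable D c r) :
    circleFlux G (planeIso c) r = (∮ z in C(c, r), D z).im := by
  rw [circleFlux, circleIntegral]
  have h := (Complex.imCLM).intervalIntegral_comp_comm hD.out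
  rw [← Complex.imCLM_apply, ← h]
  refine intervalIntegral.integral_congr fun θ _ => ?_
  have e : planeIso c + r • unitVec θ = planeIso (circleMap c r θ) := by
    rw [unitVec_eq, ← map_smul, ← map_add, circleMap, Complex.real_smul]
  have hz : ‖circleMap c r θ - c‖ = r := by simp [abs_of_nonneg hr]
  simp only [e, hG _ hz]
  simp only [unitVec_eq, planeIso.inner_map_map, Complex.inner, Complex.conj_conj,
    deriv_circleMap, smul_eq_mul, Complex.imCLM_apply, circleMap_zero]
  simp only [Complex.mul_im, Complex.mul_re, Complex.I_re, Complex.I_im, Complex.ofReal_re,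
    Complex.ofReal_im]
  ring

end TwoDisks

/-! ### Representation of the solution up to a logarithm. -/

namespace TwoDisks

open InnerProductSpace ComplexConjugate

section Representation

variable {a b c₁ r₁ c₂ r₂ : ℝ} {f : ℂ → ℂ}

lemma analyticAt_dilationSum_mobius (hf : Differentiable ℂ f) (p q : ℝ) {s t l μ : ℝ} {z : ℂ}
    (hl0 : 0 ≤ l) (hl1 : l < 1) (h0 : 0 ≤ μ) (h1 : μ < 1) (hz : z ≠ t)
    (hv : μ * ‖(z - s) / (z - t)‖ ^ 2 ≤ 1) :
    AnalyticAt ℂ (fun z : ℂ => dilationSum l (increment f p q) (μ * ((z - s) / (z - t)))) z := by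
  have hd : DifferentiableOn ℂ (dilationSum l (increment f p q)) (ball 0 1) := fun w hw =>
    (differentiableAt_dilationSum hl0 hl1 (differentiableOn_increment hf) increment_zero
      (mem_ball_zero_iff.1 hw)).differentiableWithinAt
  have h1 := hd.analyticAt (isOpen_ball.mem_nhds
    (mem_ball_zero_iff.2 (norm_mul_lt_one h0 h1 hv)))
  have h2 : AnalyticAt ℂ (fun z : ℂ => (μ : ℂ) * ((z - s) / (z - t))) z :=
    analyticAt_const.mul ((by fun_prop : AnalyticAt ℂ (fun z : ℂ => z - s) z).div (by fun_prop)
      (sub_ne_zero.2 hz))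
  exact AnalyticAt.fun_comp h1 h2

lemma LimitPoints.analyticAt_potential (h : LimitPoints a b c₁ r₁ c₂ r₂)
    (hf : Differentiable ℂ f) {z : ℂ} (hz : z ∈ closedExterior c₁ c₂ r₁ r₂) :
    AnalyticAt ℂ (potential f a b (ratio a b c₁) (ratio b a c₂)) z := by
  obtain ⟨hz₁, hz₂⟩ := hz
  have hl0 := h.multiplier_pos.le
  have hl1 := h.multiplier_lt_one
  have hk₁' := h.left.ratio_lt
  have hk₂' := h.right.ratio_lt
  have hf' := differentiable_conj_conj hf
  have m1 := (h.multiplier_mul_sq_le hz₁).trans hk₂'.le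
  have m2 := (h.symm.multiplier_mul_sq_le hz₂).trans hk₁'.le
  rw [multiplier_comm] at m2
  have hza := h.ne_left hz₁
  have hzb := h.ne_right hz₂
  exact ((((((hf.analyticAt z).sub analyticAt_const).add
    (analyticAt_dilationSum_mobius hf a b hl0 hl1 hl0 hl1 hzb m2)).add
    (analyticAt_dilationSum_mobius hf b a hl0 hl1 hl0 hl1 hza m1)).sub
    (analyticAt_dilationSum_mobius hf' a b hl0 hl1 h.left.ratio_pos.le hk₁' hza
      (h.ratio_mul_sq_le hz₁))).sub
    (analyticAt_dilationSum_mobius hf' b a hl0 hl1 h.right.ratio_pos.le hk₂' hzb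
      (h.symm.ratio_mul_sq_le hz₂)))

lemma LimitPoints.log_norm_eq (h : LimitPoints a b c₁ r₁ c₂ r₂) {z : ℂ} (hz₁ : ‖z - c₁‖ = r₁)
    (hzb : z ≠ b) :
    Real.log ‖(z - a) / (z - b)‖ = Real.log (ratio a b c₁) / 2 := by
  have hpos : 0 < ‖z - b‖ := norm_pos_iff.2 (sub_ne_zero.2 hzb)
  have : ratio a b c₁ = ‖(z - a) / (z - b)‖ ^ 2 := by
    rw [norm_div, div_pow, ← h.left.ratio_mul_eq hz₁]
    field_simp
  rw [this, Real.log_pow]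
  push_cast
  ring

lemma LimitPoints.log_norm_eq_right (h : LimitPoints a b c₁ r₁ c₂ r₂) {z : ℂ}
    (hz₂ : ‖z - c₂‖ = r₂) (hza : z ≠ a) :
    Real.log ‖(z - a) / (z - b)‖ = -(Real.log (ratio b a c₂) / 2) := by
  rw [← h.symm.log_norm_eq hz₂ hza, ← Real.log_inv, ← norm_inv, inv_div]

/-- Near z the quotient (w - s)/(z - s) is close to 1, away from the cut, which gives a local branch
of log(w - s). -/
lemma hasDerivAt_log_mobius (p q : ℝ) {z : ℂ} (hp : z ≠ p) (hq : z ≠ q) :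
    ∃ L : ℂ → ℂ, HasDerivAt L ((z - p)⁻¹ - (z - q)⁻¹) z ∧
      ∀ᶠ w : ℂ in 𝓝 z, Real.log ‖(w - p) / (w - q)‖ = (L w).re := by
  have key : ∀ s : ℝ, z ≠ s → ∃ L : ℂ → ℂ, HasDerivAt L (z - s)⁻¹ z ∧
      ∀ᶠ w : ℂ in 𝓝 z, Real.log ‖w - s‖ = (L w).re := by
    intro s hs
    have hs' : z - s ≠ 0 := sub_ne_zero.2 hs
    refine ⟨fun w => Complex.log ((w - s) / (z - s)) + Complex.log (z - s), ?_, ?_⟩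
    · have h1 : HasDerivAt (fun w : ℂ => (w - s) / (z - s)) (1 / (z - s)) z :=
        ((hasDerivAt_id z).sub_const _).div_const _
      have h2 := h1.clog (by rw [div_self hs']; exact Complex.one_mem_slitPlane)
      rw [div_self hs', div_one, one_div] at h2
      exact h2.add_const _
    · filter_upwards [isOpen_ne.mem_nhds hs] with w hw
      have hw' : w - s ≠ 0 := sub_ne_zero.2 hw
      rw [Complex.add_re, Complex.log_re, Complex.log_re, norm_div,
        Real.log_div (norm_ne_zero_iff.2 hw') (norm_ne_zero_iff.2 hs')]
      ring
  obtain ⟨L₁, h1, e1⟩ := key p hp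
  obtain ⟨L₂, h2, e2⟩ := key q hq
  refine ⟨fun w => L₁ w - L₂ w, h1.sub h2, ?_⟩
  filter_upwards [e1, e2, isOpen_ne.mem_nhds hp, isOpen_ne.mem_nhds hq] with w e1 e2 hp hq
  rw [norm_div, Real.log_div (norm_ne_zero_iff.2 (sub_ne_zero.2 hp))
    (norm_ne_zero_iff.2 (sub_ne_zero.2 hq)), e1, e2, Complex.sub_re]

lemma harmonicAt_log_mobius (p q : ℝ) {z : ℂ} (hp : z ≠ p) (hq : z ≠ q) :
    HarmonicAt (fun w : ℂ => Real.log ‖(w - p) / (w - q)‖) z :=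
  AnalyticAt.harmonicAt_log_norm (f := fun w : ℂ => (w - p) / (w - q))
    ((by fun_prop : AnalyticAt ℂ (fun z : ℂ => z - p) z).div (by fun_prop) (sub_ne_zero.2 hq))
    (div_ne_zero (sub_ne_zero.2 hp) (sub_ne_zero.2 hq))

end Representation

section Solution

variable {a b r₁ r₂ ε C₁ C₂ : ℝ} {f : ℂ → ℂ} {H u : Plane → ℝ}

/-- The data of the limit points of the two disks `D₁`, `D₂`. -/
abbrev DiskLimitPoints (a b r₁ r₂ ε : ℝ) : Prop := LimitPoints a b (r₁ + ε) r₁ (-r₂ - ε) r₂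

/-- The complex potential of the two disks `D₁`, `D₂`. -/
abbrev diskPotential (f : ℂ → ℂ) (a b r₁ r₂ ε : ℝ) : ℂ → ℂ :=
  potential f a b (ratio a b (r₁ + ε)) (ratio b a (-r₂ - ε))

lemma lt_norm_sub_of_left (hr₁ : 0 < r₁) (hr₂ : 0 < r₂) (hε : 0 < ε) {z : ℂ}
    (hz : ‖z - ((r₁ + ε : ℝ) : ℂ)‖ = r₁) : r₂ < ‖z - ((-r₂ - ε : ℝ) : ℂ)‖ := by
  have h1 : ‖((r₁ + ε : ℝ) : ℂ) - ((-r₂ - ε : ℝ) : ℂ)‖ = r₁ + r₂ + 2 * ε := by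
    rw [← Complex.ofReal_sub, Complex.norm_real, Real.norm_of_nonneg (by linarith)]
    ring
  have h2 := norm_sub_le_norm_sub_add_norm_sub ((r₁ + ε : ℝ) : ℂ) z ((-r₂ - ε : ℝ) : ℂ)
  rw [norm_sub_rev _ z, hz, h1] at h2
  linarith

lemma lt_norm_sub_of_right (hr₁ : 0 < r₁) (hr₂ : 0 < r₂) (hε : 0 < ε) {z : ℂ}
    (hz : ‖z - ((-r₂ - ε : ℝ) : ℂ)‖ = r₂) : r₁ < ‖z - ((r₁ + ε : ℝ) : ℂ)‖ := by
  have h1 : ‖((r₁ + ε : ℝ) : ℂ) - ((-r₂ - ε : ℝ) : ℂ)‖ = r₁ + r₂ + 2 * ε := by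
    rw [← Complex.ofReal_sub, Complex.norm_real, Real.norm_of_nonneg (by linarith)]
    ring
  have h2 := norm_sub_le_norm_sub_add_norm_sub ((r₁ + ε : ℝ) : ℂ) z ((-r₂ - ε : ℝ) : ℂ)
  rw [norm_sub_rev _ z, hz, h1] at h2
  linarith

lemma mem_boundary {z : ℂ} (hz : z ∈ closedExt r₁ r₂ ε) (hz' : z ∉ openExt r₁ r₂ ε) :
    ‖z - ((r₁ + ε : ℝ) : ℂ)‖ = r₁ ∨ ‖z - ((-r₂ - ε : ℝ) : ℂ)‖ = r₂ := by
  by_contra! hne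
  exact hz' ⟨lt_of_le_of_ne hz.1 hne.1.symm, lt_of_le_of_ne hz.2 hne.2.symm⟩

lemma IsSolution.apply_left (hu : IsSolution r₁ r₂ ε H u C₁ C₂) {z : ℂ}
    (hz : ‖z - ((r₁ + ε : ℝ) : ℂ)‖ = r₁) : u (planeIso z) = C₁ :=
  hu.boundary₁ _ (by rw [mem_sphere, center₁_eq, dist_planeIso, hz])

lemma IsSolution.apply_right (hu : IsSolution r₁ r₂ ε H u C₁ C₂) {z : ℂ}
    (hz : ‖z - ((-r₂ - ε : ℝ) : ℂ)‖ = r₂) : u (planeIso z) = C₂ :=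
  hu.boundary₂ _ (by rw [mem_sphere, center₂_eq, dist_planeIso, hz])

lemma tendsto_planeIso_cobounded :
    Tendsto planeIso (Bornology.cobounded ℂ) (Bornology.cobounded Plane) :=
  planeIso.antilipschitz.tendsto_cobounded

lemma IsSolution.sub_isBigO (hu : IsSolution r₁ r₂ ε H u C₁ C₂)
    (hH : ∀ z, H (planeIso z) = (f z).re) :
    (fun z => u (planeIso z) - (f z).re) =O[Bornology.cobounded ℂ] fun _ => (1 : ℝ) := by
  have h0 : Tendsto (fun x : Plane => ‖x‖⁻¹) (Bornology.cobounded Plane) (𝓝 0) :=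
    tendsto_norm_cobounded_atTop.inv_tendsto_atTop
  have h1 := (hu.decay.trans (h0.isBigO_one ℝ)).comp_tendsto tendsto_planeIso_cobounded
  refine h1.congr_left fun z => ?_
  simp [hH]

/-- Up to a constant and a multiple of `log |(z - a) / (z - b)|`, the solution is the real part of
the complex potential. -/
theorem IsSolution.exists_eq_add_log (hu : IsSolution r₁ r₂ ε H u C₁ C₂)
    (hL : DiskLimitPoints a b r₁ r₂ ε) (hf : Differentiable ℂ f)
    (hH : ∀ z, H (planeIso z) = (f z).re) :
    ∃ α β : ℝ, ∀ z ∈ closedExt r₁ r₂ ε, u (planeIso z) =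
      (diskPotential f a b r₁ r₂ ε z).re + α + β * Real.log ‖(z - a) / (z - b)‖ := by
  have hr₁ := hL.left.pos
  have hr₂ := hL.right.pos
  set k₁ := ratio a b (r₁ + ε) with hk₁
  set k₂ := ratio b a (-r₂ - ε) with hk₂
  have hl₁ : Real.log k₁ < 0 := Real.log_neg hL.left.ratio_pos hL.left.ratio_lt
  have hl₂ : Real.log k₂ < 0 := Real.log_neg hL.right.ratio_pos hL.right.ratio_lt
  -- The logarithm equals log k₁/2 on ∂D₁ and -log k₂/2 on ∂D₂. Matching both boundary values is a
  -- linear system for α and β, solvable because both logarithms of the ratios are negative.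
  obtain ⟨β, hβ⟩ : ∃ β : ℝ, β * (Real.log k₁ / 2 + Real.log k₂ / 2) =
      C₁ - C₂ + ((f b).re - (f a).re) := by
    refine ⟨(C₁ - C₂ + ((f b).re - (f a).re)) / (Real.log k₁ / 2 + Real.log k₂ / 2), ?_⟩
    exact div_mul_cancel₀ _ (by linarith)
  set α := C₁ - β * (Real.log k₁ / 2) with hα
  refine ⟨α, β, fun z hz => ?_⟩
  set Φ := diskPotential f a b r₁ r₂ ε with hΦ
  have hΦre : ∀ z ∈ closedExt r₁ r₂ ε, AnalyticAt ℂ Φ z := fun z hz => hL.analyticAt_potential hf hz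
  have hne : ∀ z ∈ closedExt r₁ r₂ ε, z ≠ a ∧ z ≠ b := fun z hz =>
    ⟨hL.ne_left hz.1, hL.ne_right hz.2⟩
  let W : ℂ → ℝ := fun z => u (planeIso z) - (Φ z).re - α - β * Real.log ‖(z - a) / (z - b)‖
  have hzero : W z = 0 := by
    refine harmonic_exterior_eq_zero hr₁ (fun x hx => ?_) ?_ (fun x hx hx' => ?_) ?_ hz
    · have hxc := openExterior_subset hx
      have h1 := harmonicAt_comp_planeIso
        (hu.harmonic _ ((planeIso_mem_compl_closure hr₁ hr₂).2 hx))
      exact ((h1.sub (hΦre x hxc).harmonicAt_re).sub (harmonicAt_const α)).sub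
        ((harmonicAt_log_mobius a b (hne x hxc).1 (hne x hxc).2).const_smul (c := β))
    · have h1 : ContinuousOn (fun z => u (planeIso z)) (closedExt r₁ r₂ ε) :=
        hu.continuousOn.comp planeIso.continuous.continuousOn
          fun x hx => planeIso_mem_compl_disks.2 hx
      refine ((h1.sub (fun x hx => ?_)).sub continuousOn_const).sub
        (continuousOn_const.mul fun x hx => ?_)
      · exact (Complex.continuous_re.continuousAt.comp
          (hΦre x hx).continuousAt).continuousWithinAt
      · exact (harmonicAt_log_mobius a b (hne x hx).1
          (hne x hx).2).1.continuousAt.continuousWithinAt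
    · rcases mem_boundary hx hx' with h | h
      · have e1 : (Φ x).re = 0 := hL.potential_eq_left hf h (hne x hx).2
        simp only [W]
        rw [hu.apply_left h, e1, hL.log_norm_eq h (hne x hx).2]
        ring
      · have e1 : (Φ x).re = (f b).re - (f a).re := hL.potential_eq_right hf h (hne x hx).1
        simp only [W]
        rw [hu.apply_right h, e1, hL.log_norm_eq_right h (hne x hx).1]
        linarith
    · have h1 := hu.sub_isBigO hH
      have h2 : (fun z => (Φ z - f z).re) =O[Bornology.cobounded ℂ] fun _ => (1 : ℝ) :=
        (Asymptotics.isBigO_of_le _ fun z => Complex.abs_re_le_norm _).trans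
          (hL.potential_sub_isBigO hf)
      have h3 : Tendsto (fun z : ℂ => Real.log ‖(z - a) / (z - b)‖) (Bornology.cobounded ℂ)
          (𝓝 (Real.log ‖(1 : ℂ)‖)) :=
        (tendsto_mobius a b).norm.log (by simp)
      have h4 := (h3.isBigO_one ℝ).const_mul_left β
      have h5 : (fun _ : ℂ => α) =O[Bornology.cobounded ℂ] fun _ => (1 : ℝ) :=
        Asymptotics.isBigO_const_const α one_ne_zero _
      refine (((h1.sub h2).sub h5).sub h4).congr_left fun x => ?_
      simp only [W, Complex.sub_re]
      ring
  simp only [W] at hzero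
  linarith

end Solution

end TwoDisks

/-! ### The flux condition removes the logarithm. -/

namespace TwoDisks

open InnerProductSpace ComplexConjugate

lemma InversePair.abs_left_lt {p q c r : ℝ} (h : InversePair p q c r) : |c - p| < r := by
  have h1 : (c - p) ^ 2 = (c - p) / (c - q) * r ^ 2 := by
    rw [← h.mul_eq]; field_simp [h.sub_ne_zero]
  have h2 := mul_lt_of_lt_one_left (pow_pos h.pos 2) h.ratio_lt
  rw [← h1] at h2
  exact abs_lt_of_sq_lt_sq h2 h.pos.le

lemma InversePair.lt_abs_right {p q c r : ℝ} (h : InversePair p q c r) : r < |c - q| := by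
  have h1 := h.abs_left_lt
  have h2 := congrArg abs h.mul_eq
  rw [abs_mul, abs_of_nonneg (sq_nonneg r)] at h2
  have h3 : 0 < |c - q| := abs_pos.2 h.sub_ne_zero
  have hr := h.pos
  nlinarith

section Flux

variable {a b r₁ r₂ ε C₁ C₂ : ℝ} {f : ℂ → ℂ} {H u : Plane → ℝ}

lemma InversePair.circleIntegral_sub_inv {p q c r : ℝ} (h : InversePair p q c r) :
    (∮ z in C((c : ℂ), r), ((z - p)⁻¹ - (z - q)⁻¹)) = 2 * Real.pi * Complex.I := by
  have hp : ‖(p : ℂ) - c‖ < r := by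
    rw [← Complex.ofReal_sub, Complex.norm_real, Real.norm_eq_abs, abs_sub_comm]
    exact h.abs_left_lt
  have hq : r < ‖(q : ℂ) - c‖ := by
    rw [← Complex.ofReal_sub, Complex.norm_real, Real.norm_eq_abs, abs_sub_comm]
    exact h.lt_abs_right
  have hqn : ∀ z ∈ closedBall (c : ℂ) r, z - q ≠ 0 := fun z hz h0 => by
    rw [mem_closedBall, dist_eq_norm, sub_eq_zero.1 h0] at hz
    linarith
  have h1 : CircleIntegrable (fun z : ℂ => (z - p)⁻¹) c r := by
    refine ContinuousOn.circleIntegrable h.pos.le (ContinuousOn.inv₀ (by fun_prop) fun z hz h0 => ?_)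
    rw [mem_sphere, dist_eq_norm, sub_eq_zero.1 h0] at hz
    linarith
  have h2 : CircleIntegrable (fun z : ℂ => (z - q)⁻¹) c r :=
    ContinuousOn.circleIntegrable h.pos.le (ContinuousOn.inv₀ (by fun_prop)
      fun z hz => hqn z (sphere_subset_closedBall hz))
  have h3 : (∮ z in C((c : ℂ), r), (z - q)⁻¹) = 0 := by
    refine Complex.circleIntegral_eq_zero_of_differentiable_on_off_countable h.pos.le
      countable_empty (ContinuousOn.inv₀ (by fun_prop) hqn) fun z hz => ?_
    exact DifferentiableAt.inv (by fun_prop) (hqn z (ball_subset_closedBall hz.1))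
  rw [circleIntegral.integral_sub h1 h2, h3, sub_zero,
    circleIntegral.integral_sub_inv_of_mem_ball (by rw [mem_ball, dist_eq_norm]; exact hp)]

/-- Every point of the first circle is a limit of points of the open exterior. -/
lemma mem_closure_openExt (hr₁ : 0 < r₁) (hr₂ : 0 < r₂) (hε : 0 < ε) {z : ℂ}
    (hz : ‖z - ((r₁ + ε : ℝ) : ℂ)‖ = r₁) : z ∈ closure (openExt r₁ r₂ ε) := by
  set c : ℂ := ((r₁ + ε : ℝ) : ℂ)
  have hz₂ := lt_norm_sub_of_left hr₁ hr₂ hε hz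
  have ht : Tendsto (fun t : ℝ => z + (t : ℂ) * (z - c)) (𝓝[>] 0) (𝓝 z) := by
    have : Tendsto (fun t : ℝ => z + (t : ℂ) * (z - c)) (𝓝 0)
        (𝓝 (z + ((0 : ℝ) : ℂ) * (z - c))) := Continuous.tendsto (by fun_prop) 0
    rw [Complex.ofReal_zero, zero_mul, add_zero] at this
    exact this.mono_left nhdsWithin_le_nhds
  refine mem_closure_of_tendsto ht ?_
  have hev : ∀ᶠ w : ℂ in 𝓝 z, r₂ < ‖w - ((-r₂ - ε : ℝ) : ℂ)‖ :=
    (isOpen_lt (by fun_prop) (by fun_prop)).mem_nhds hz₂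
  filter_upwards [ht.eventually hev, self_mem_nhdsWithin] with t h2 ht0
  refine ⟨?_, h2⟩
  have ht0' : 0 < t := ht0
  have e : z + (t : ℂ) * (z - c) - c = ((1 + t : ℝ) : ℂ) * (z - c) := by push_cast; ring
  change r₁ < ‖z + (t : ℂ) * (z - c) - c‖
  rw [e, norm_mul, hz, Complex.norm_real, Real.norm_of_nonneg (by linarith)]
  nlinarith

lemma continuousAt_mul_sub_inv (β : ℝ) {p q : ℝ} {z : ℂ} (hp : z ≠ p) (hq : z ≠ q) :
    ContinuousAt (fun z : ℂ => (β : ℂ) * ((z - p)⁻¹ - (z - q)⁻¹)) z := by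
  have h : ∀ s : ℝ, z ≠ s → ContinuousAt (fun z : ℂ => (z - s)⁻¹) z := fun s hs =>
    (by fun_prop : ContinuousAt (fun z : ℂ => z - s) z).inv₀ (sub_ne_zero.2 hs)
  exact continuousAt_const.mul ((h p hp).sub (h q hq))

/-- The flux through ∂D₁ is the imaginary part of a contour integral. The derivative of the
single-valued potential integrates to 0, while β((z - a)⁻¹ - (z - b)⁻¹) gives 2πiβ, as a is inside
and b outside. -/
theorem IsSolution.exists_eq_potential (hu : IsSolution r₁ r₂ ε H u C₁ C₂) (hε : 0 < ε)
    (hL : DiskLimitPoints a b r₁ r₂ ε) (hf : Differentiable ℂ f)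
    (hH : ∀ z, H (planeIso z) = (f z).re) :
    ∃ α : ℝ, ∀ z ∈ closedExt r₁ r₂ ε, u (planeIso z) = (diskPotential f a b r₁ r₂ ε z).re + α := by
  have hr₁ := hL.left.pos
  have hr₂ := hL.right.pos
  obtain ⟨α, β, hαβ⟩ := hu.exists_eq_add_log hL hf hH
  set Φ := diskPotential f a b r₁ r₂ ε with hΦ
  have hΦre : ∀ z ∈ closedExt r₁ r₂ ε, AnalyticAt ℂ Φ z := fun z hz => hL.analyticAt_potential hf hz
  have hne : ∀ z ∈ closedExt r₁ r₂ ε, z ≠ a ∧ z ≠ b := fun z hz =>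
    ⟨hL.ne_left hz.1, hL.ne_right hz.2⟩
  suffices hβ : β = 0 by
    refine ⟨α, fun z hz => ?_⟩
    rw [hαβ z hz, hβ, zero_mul, add_zero]
  obtain ⟨G, hGc, hG, hflux, -⟩ := hu.flux
  let D : ℂ → ℂ := fun z => deriv Φ z + β * ((z - a)⁻¹ - (z - b)⁻¹)
  have hDc : ContinuousOn D (closedExt r₁ r₂ ε) := by
    intro z hz
    exact ((hΦre z hz).deriv.continuousAt.add
      (continuousAt_mul_sub_inv β (hne z hz).1 (hne z hz).2)).continuousWithinAt
  have hGD : ∀ z ∈ openExt r₁ r₂ ε, G (planeIso z) = planeIso (conj (D z)) := by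
    intro z hz
    have hzc := openExterior_subset hz
    obtain ⟨Λ, hΛ, hΛe⟩ := hasDerivAt_log_mobius a b (hne z hzc).1 (hne z hzc).2
    rw [hG _ ((planeIso_mem_compl_closure hr₁ hr₂).2 hz)]
    refine (hasGradientAt_of_re (Ψ := fun w => Φ w + α + β * Λ w)
      (((hΦre z hzc).differentiableAt.hasDerivAt.add_const (α : ℂ)).add (hΛ.const_mul (β : ℂ)))
      ?_).gradient
    filter_upwards [isOpen_openExterior.mem_nhds hz, hΛe] with w hw hwe
    rw [hαβ w (openExterior_subset hw), hwe]
    simp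
  have hS : ∀ z : ℂ, ‖z - ((r₁ + ε : ℝ) : ℂ)‖ = r₁ → z ∈ closedExt r₁ r₂ ε := fun z hz =>
    ⟨hz.ge, (lt_norm_sub_of_left hr₁ hr₂ hε hz).le⟩
  -- The formula for the gradient field holds in the open exterior; both sides are continuous up to
  -- the circle, whose points are limits of exterior points.
  have hGS : ∀ z : ℂ, ‖z - ((r₁ + ε : ℝ) : ℂ)‖ = r₁ → G (planeIso z) = planeIso (conj (D z)) := by
    intro z hz
    let T : Set ℂ := openExt r₁ r₂ ε ∪ {z}
    have hTsub : T ⊆ closedExt r₁ r₂ ε :=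
      union_subset openExterior_subset (singleton_subset_iff.2 (hS z hz))
    have h1 : ContinuousOn (fun z => G (planeIso z)) T :=
      hGc.comp planeIso.continuous.continuousOn
        fun x hx => planeIso_mem_compl_disks.2 (hTsub hx)
    have h2 : ContinuousOn (fun z => planeIso (conj (D z))) T :=
      planeIso.continuous.comp_continuousOn
        (Complex.continuous_conj.comp_continuousOn (hDc.mono hTsub))
    exact EqOn.of_subset_closure (s := openExt r₁ r₂ ε) hGD h1 h2 subset_union_left
      (union_subset subset_closure
        (singleton_subset_iff.2 (mem_closure_openExt hr₁ hr₂ hε hz))) (mem_union_right _ rfl)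
  have hsph : sphere ((r₁ + ε : ℝ) : ℂ) r₁ ⊆ closedExt r₁ r₂ ε := fun z hz =>
    hS z (by rwa [mem_sphere, dist_eq_norm] at hz)
  have hDi : CircleIntegrable D ((r₁ + ε : ℝ) : ℂ) r₁ :=
    (hDc.mono hsph).circleIntegrable hr₁.le
  rw [center₁_eq, circleFlux_eq hr₁.le hGS hDi] at hflux
  have hi1 : CircleIntegrable (deriv Φ) ((r₁ + ε : ℝ) : ℂ) r₁ :=
    ContinuousOn.circleIntegrable hr₁.le
      fun z hz => (hΦre z (hsph hz)).deriv.continuousAt.continuousWithinAt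
  have hi2 : CircleIntegrable (fun z : ℂ => (β : ℂ) * ((z - a)⁻¹ - (z - b)⁻¹))
      ((r₁ + ε : ℝ) : ℂ) r₁ := by
    refine ContinuousOn.circleIntegrable hr₁.le fun z hz => ?_
    exact (continuousAt_mul_sub_inv β (hne z (hsph hz)).1
      (hne z (hsph hz)).2).continuousWithinAt
  have hI1 : (∮ z in C(((r₁ + ε : ℝ) : ℂ), r₁), deriv Φ z) = 0 :=
    circleIntegral.integral_eq_zero_of_hasDerivWithinAt hr₁.le fun z hz =>
      (hΦre z (hsph hz)).differentiableAt.hasDerivAt.hasDerivWithinAt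
  have hI : (∮ z in C(((r₁ + ε : ℝ) : ℂ), r₁), D z) = β * (2 * Real.pi * Complex.I) := by
    simp only [D]
    rw [circleIntegral.integral_add hi1 hi2, hI1, zero_add,
      circleIntegral.integral_const_mul, hL.left.circleIntegral_sub_inv]
  rw [hI] at hflux
  have hpi := Real.pi_pos
  have : β * (2 * Real.pi) = 0 := by simpa using hflux
  rcases mul_eq_zero.1 this with h | h
  · exact h
  · linarith

theorem IsSolution.sub_eq (hu : IsSolution r₁ r₂ ε H u C₁ C₂) (hε : 0 < ε)
    (hL : DiskLimitPoints a b r₁ r₂ ε) (hf : Differentiable ℂ f)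
    (hH : ∀ z, H (planeIso z) = (f z).re) : C₁ - C₂ = H (planeIso a) - H (planeIso b) := by
  have hr₁ := hL.left.pos
  have hr₂ := hL.right.pos
  obtain ⟨α, hα⟩ := hu.exists_eq_potential hε hL hf hH
  have hz₁ : ‖((ε : ℝ) : ℂ) - ((r₁ + ε : ℝ) : ℂ)‖ = r₁ := by
    rw [← Complex.ofReal_sub, Complex.norm_real, Real.norm_eq_abs]
    rw [show ε - (r₁ + ε) = -r₁ by ring, abs_neg, abs_of_pos hr₁]
  have hz₂ : ‖((-ε : ℝ) : ℂ) - ((-r₂ - ε : ℝ) : ℂ)‖ = r₂ := by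
    rw [← Complex.ofReal_sub, Complex.norm_real, Real.norm_eq_abs]
    rw [show -ε - (-r₂ - ε) = r₂ by ring, abs_of_pos hr₂]
  have m₁ := lt_norm_sub_of_left hr₁ hr₂ hε hz₁
  have m₂ := lt_norm_sub_of_right hr₁ hr₂ hε hz₂
  have e₁ := hα _ ⟨hz₁.ge, m₁.le⟩
  have e₂ := hα _ ⟨m₂.le, hz₂.ge⟩
  rw [hu.apply_left hz₁, hL.potential_eq_left hf hz₁ (hL.ne_right m₁.le)] at e₁
  rw [hu.apply_right hz₂, hL.potential_eq_right hf hz₂ (hL.ne_left m₂.le)] at e₂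
  rw [hH, hH]
  linarith

theorem IsSolution.gradient_eq (hu : IsSolution r₁ r₂ ε H u C₁ C₂) (hε : 0 < ε)
    (hL : DiskLimitPoints a b r₁ r₂ ε) (hf : Differentiable ℂ f)
    (hH : ∀ z, H (planeIso z) = (f z).re) {z : ℂ} (hz : z ∈ openExt r₁ r₂ ε) :
    gradient u (planeIso z) = planeIso (conj (deriv (diskPotential f a b r₁ r₂ ε) z)) := by
  obtain ⟨α, hα⟩ := hu.exists_eq_potential hε hL hf hH
  have hd := (hL.analyticAt_potential hf (openExterior_subset hz)).differentiableAt.hasDerivAt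
  refine (hasGradientAt_of_re (hd.add_const (α : ℂ)) ?_).gradient
  filter_upwards [isOpen_openExterior.mem_nhds hz] with w hw
  rw [hα w (openExterior_subset hw)]
  simp

end Flux

end TwoDisks

/-! ### Fixed points of the composed reflections. -/

namespace TwoDisks

open ComplexConjugate

section FixedPoints

variable {a b c₁ r₁ c₂ r₂ ε : ℝ}

lemma inversion_planeIso (c r : ℝ) (z : ℂ) :
    EuclideanGeometry.inversion (planeIso c) r (planeIso z) =
      planeIso (r ^ 2 / conj (z - c) + c) := by
  rw [EuclideanGeometry.inversion, vsub_eq_sub, vadd_eq_add, ← map_sub, ← map_smul, ← map_add,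
    dist_planeIso, Complex.real_smul]
  congr 2
  by_cases hz : z - c = 0
  · simp [hz]
  have hz' : conj (z - c) ≠ 0 := (map_ne_zero _).2 hz
  have hn : ((‖z - c‖ : ℝ) : ℂ) ^ 2 = (z - c) * conj (z - c) := by
    rw [Complex.mul_conj, Complex.normSq_eq_norm_sq]; push_cast; rfl
  push_cast
  rw [div_pow, hn]
  field_simp

lemma inversion_planeIso_eq {p q c r : ℝ} (hp : c - p ≠ 0) (h : (c - p) * (c - q) = r ^ 2) :
    EuclideanGeometry.inversion (planeIso c) r (planeIso p) = planeIso q := by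
  rw [inversion_planeIso, ← Complex.ofReal_sub, Complex.conj_ofReal]
  congr 1
  have : r ^ 2 / (p - c) + c = q := by
    have : p - c ≠ 0 := fun h => hp (by linarith)
    rw [← h]; field_simp; ring
  exact_mod_cast this

lemma InversePair.inversion_right {p q c r : ℝ} (h : InversePair p q c r) :
    EuclideanGeometry.inversion (planeIso c) r (planeIso q) = planeIso p :=
  inversion_planeIso_eq h.sub_ne_zero (by rw [mul_comm]; exact h.mul_eq)

/-- With ζ = conj z and w = R₂ z, a fixed point satisfies (w - cᵢ)(ζ - cᵢ) = rᵢ² for both i, the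
same equations as a and b. Their difference is linear and gives w = a + b - ζ, so (ζ - a)(ζ - b) =
0; the root b lies outside the first disk. -/
lemma LimitPoints.fixedPoint_iff (h : LimitPoints a b c₁ r₁ c₂ r₂) (hd : r₁ + r₂ < |c₁ - c₂|)
    {p : Plane} : (p ∈ ball (planeIso c₁) r₁ ∧ EuclideanGeometry.inversion (planeIso c₁) r₁
      (EuclideanGeometry.inversion (planeIso c₂) r₂ p) = p) ↔ p = planeIso a := by
  have hr₁ := h.left.pos
  have hr₂ := h.right.pos
  have hd0 : c₁ - c₂ ≠ 0 := fun h0 => by rw [h0, abs_zero] at hd; linarith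
  constructor
  swap
  · rintro rfl
    refine ⟨?_, by rw [h.right.inversion_right, h.left.inversion_right]⟩
    rw [mem_ball, dist_planeIso, ← Complex.ofReal_sub, Complex.norm_real, Real.norm_eq_abs,
      abs_sub_comm]
    exact h.left.abs_left_lt
  rintro ⟨hp, hfix⟩
  obtain ⟨z, rfl⟩ := planeIso.surjective p
  rw [mem_ball, dist_planeIso] at hp
  set ζ := conj z with hζ
  have hnorm : ∀ c : ℝ, ‖ζ - c‖ = ‖z - c‖ := fun c => by
    rw [← Complex.norm_conj (z - c), map_sub, Complex.conj_ofReal]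
  set w : ℂ := r₂ ^ 2 / conj (z - c₂) + c₂ with hw
  rw [inversion_planeIso, ← hw, inversion_planeIso, planeIso.injective.eq_iff] at hfix
  -- `inversion` fixes its centre, so z = c₂ and R₂ z = c₁ need separate exclusion; both contradict
  -- r₁ + r₂ < |c₁ - c₂|.
  have hζ₂ : ζ - c₂ ≠ 0 := by
    intro h0
    have h1 : ζ = c₂ := sub_eq_zero.1 h0
    rw [← hnorm, h1, ← Complex.ofReal_sub, Complex.norm_real, Real.norm_eq_abs,
      abs_sub_comm] at hp
    linarith
  have e₂ : (w - c₂) * (ζ - c₂) = r₂ ^ 2 := by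
    rw [hw, map_sub, Complex.conj_ofReal, add_sub_cancel_right, div_mul_cancel₀ _ hζ₂]
  have hw₁ : w - c₁ ≠ 0 := by
    intro h0
    rw [h0, map_zero, div_zero, zero_add] at hfix
    have h1 : ζ = c₁ := by rw [hζ, ← hfix, Complex.conj_ofReal]
    rw [h1, sub_eq_zero.1 h0] at e₂
    have e3 : (c₁ - c₂) * (c₁ - c₂) = r₂ ^ 2 := by exact_mod_cast e₂
    rw [← abs_mul_abs_self (c₁ - c₂)] at e3
    nlinarith
  have e₁ : (w - c₁) * (ζ - c₁) = r₁ ^ 2 := by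
    have h1 : ζ - c₁ = r₁ ^ 2 / (w - c₁) := by
      rw [hζ, ← hfix]
      simp
    rw [h1, mul_div_cancel₀ _ hw₁]
  have f₁ : ((c₁ : ℂ) - a) * (c₁ - b) = r₁ ^ 2 := by exact_mod_cast h.left.mul_eq
  have f₂ : ((c₂ : ℂ) - b) * (c₂ - a) = r₂ ^ 2 := by exact_mod_cast h.right.mul_eq
  have hd0' : (c₁ : ℂ) - c₂ ≠ 0 := by exact_mod_cast hd0
  have hsum : w = a + b - ζ := by
    apply mul_left_cancel₀ hd0'
    linear_combination e₂ - e₁ - f₂ + f₁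
  have hprod : (ζ - a) * (ζ - b) = 0 := by
    rw [hsum] at e₁
    linear_combination f₁ - e₁
  rcases mul_eq_zero.1 hprod with h0 | h0
  · rw [← Complex.conj_conj z, ← hζ, sub_eq_zero.1 h0, Complex.conj_ofReal]
  · exfalso
    rw [← hnorm, sub_eq_zero.1 h0, ← Complex.ofReal_sub, Complex.norm_real, Real.norm_eq_abs,
      abs_sub_comm] at hp
    exact absurd hp (not_lt.2 h.left.lt_abs_right.le)

lemma DiskLimitPoints.fixedPoint₁_iff (h : DiskLimitPoints a b r₁ r₂ ε) (hε : 0 < ε) {p : Plane} :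
    IsFixedPoint₁ r₁ r₂ ε p ↔ p = planeIso a := by
  have hr₁ := h.left.pos
  have hr₂ := h.right.pos
  rw [IsFixedPoint₁, disk₁, reflection₁, reflection₂, center₁_eq, center₂_eq]
  exact h.fixedPoint_iff (lt_of_lt_of_le (by linarith) (le_abs_self _))

lemma DiskLimitPoints.fixedPoint₂_iff (h : DiskLimitPoints a b r₁ r₂ ε) (hε : 0 < ε) {p : Plane} :
    IsFixedPoint₂ r₁ r₂ ε p ↔ p = planeIso b := by
  have hr₁ := h.left.pos
  have hr₂ := h.right.pos
  rw [IsFixedPoint₂, disk₂, reflection₁, reflection₂, center₁_eq, center₂_eq]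
  exact h.symm.fixedPoint_iff (lt_of_lt_of_le (by linarith) (neg_le_abs _))

/-- The common inverse points of the two disks, with their sum and product. -/
theorem exists_diskLimitPoints (hr₁ : 0 < r₁) (hr₂ : 0 < r₂) (hε : 0 < ε) :
    ∃ a b : ℝ, DiskLimitPoints a b r₁ r₂ ε ∧ b < 0 ∧ 0 < a ∧
      (a + b) * (r₁ + r₂ + 2 * ε) = 2 * ε * (r₁ - r₂) ∧
      -(a * b) * (r₁ + r₂ + 2 * ε) =
        4 * ε * (r₁ * r₂) + 3 * ε ^ 2 * (r₁ + r₂) + 2 * ε ^ 3 := by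
  -- Subtracting the two inversion equations determines s = a + b, and either of them then gives N =
  -- -ab; a and b are the roots of x² - sx - N.
  set t := r₁ + r₂ + 2 * ε with ht
  have ht0 : 0 < t := by positivity
  set s := 2 * ε * (r₁ - r₂) / t with hs
  set N := (4 * ε * (r₁ * r₂) + 3 * ε ^ 2 * (r₁ + r₂) + 2 * ε ^ 3) / t with hN
  have hN0 : 0 < N := by positivity
  set d := Real.sqrt (s ^ 2 + 4 * N) with hd
  have hd2 : d ^ 2 = s ^ 2 + 4 * N := Real.sq_sqrt (by positivity)
  have hd0 : 0 ≤ d := Real.sqrt_nonneg _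
  have hsd : |s| < d := abs_lt_of_sq_lt_sq (by linarith) hd0
  obtain ⟨hsd1, hsd2⟩ := abs_lt.1 hsd
  have hst : s * t = 2 * ε * (r₁ - r₂) := div_mul_cancel₀ _ ht0.ne'
  have hNt : N * t = 4 * ε * (r₁ * r₂) + 3 * ε ^ 2 * (r₁ + r₂) + 2 * ε ^ 3 :=
    div_mul_cancel₀ _ ht0.ne'
  have hb : (s - d) / 2 < 0 := by linarith
  have ha : 0 < (s + d) / 2 := by linarith
  have hprod : (s + d) / 2 * ((s - d) / 2) = -N := by linarith
  have e₁ : (r₁ + ε - (s + d) / 2) * (r₁ + ε - (s - d) / 2) = r₁ ^ 2 := by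
    have : (r₁ + ε - (s + d) / 2) * (r₁ + ε - (s - d) / 2) =
      (r₁ + ε) ^ 2 - (r₁ + ε) * s - N := by linarith
    rw [this]
    apply mul_right_cancel₀ ht0.ne'
    rw [sub_mul, sub_mul, hNt, mul_assoc, hst, ht]
    ring
  have e₂ : (-r₂ - ε - (s - d) / 2) * (-r₂ - ε - (s + d) / 2) = r₂ ^ 2 := by
    have : (-r₂ - ε - (s - d) / 2) * (-r₂ - ε - (s + d) / 2) =
      (r₂ + ε) ^ 2 + (r₂ + ε) * s - N := by linarith
    rw [this]
    apply mul_right_cancel₀ ht0.ne'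
    rw [sub_mul, add_mul, hNt, mul_assoc, hst, ht]
    ring
  refine ⟨(s + d) / 2, (s - d) / 2, ⟨⟨hr₁, e₁, ?_, ?_⟩, ⟨hr₂, e₂, ?_, ?_⟩⟩, hb, ha, ?_, ?_⟩
  · have h1 : 0 < r₁ + ε - (s - d) / 2 := by linarith
    have h2 : 0 < r₁ + ε - (s + d) / 2 := by
      by_contra! hneg
      nlinarith [pow_pos hr₁ 2]
    exact div_pos h2 h1
  · rw [div_lt_one (by linarith)]; linarith
  · have h1 : -r₂ - ε - (s + d) / 2 < 0 := by linarith
    have h2 : -r₂ - ε - (s - d) / 2 < 0 := by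
      by_contra! hneg
      nlinarith [pow_pos hr₂ 2]
    exact div_pos_of_neg_of_neg h2 h1
  · rw [div_lt_one_of_neg (by linarith)]; linarith
  · rw [← hst]; ring
  · rw [hprod, neg_neg, hNt]

end FixedPoints

end TwoDisks

/-! ### Size of a - b and expansion of the potential difference. -/

namespace TwoDisks

open InnerProductSpace ComplexConjugate

section Estimates

variable {a b r₁ r₂ ε : ℝ}

/-- The sum and product relations satisfied by the limit points `a > 0 > b`. -/
structure LimitPointRelations (a b r₁ r₂ ε : ℝ) : Prop where
  r₁_pos : 0 < r₁
  r₂_pos : 0 < r₂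
  eps_pos : 0 < ε
  b_neg : b < 0
  a_pos : 0 < a
  sum_eq : (a + b) * (r₁ + r₂ + 2 * ε) = 2 * ε * (r₁ - r₂)
  prod_eq : -(a * b) * (r₁ + r₂ + 2 * ε) =
    4 * ε * (r₁ * r₂) + 3 * ε ^ 2 * (r₁ + r₂) + 2 * ε ^ 3

namespace LimitPointRelations

lemma harmonic_mean (h : LimitPointRelations a b r₁ r₂ ε) :
    r₁ * r₂ / (r₁ + r₂) * (r₁ + r₂) = r₁ * r₂ :=
  div_mul_cancel₀ _ (add_pos h.r₁_pos h.r₂_pos).ne'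

lemma mean_pos (h : LimitPointRelations a b r₁ r₂ ε) : 0 < r₁ * r₂ / (r₁ + r₂) :=
  div_pos (mul_pos h.r₁_pos h.r₂_pos) (add_pos h.r₁_pos h.r₂_pos)

lemma sq_sub_le (h : LimitPointRelations a b r₁ r₂ ε) :
    (a - b) ^ 2 ≤ 16 * (r₁ * r₂ / (r₁ + r₂)) * ε + 20 * ε ^ 2 := by
  have hr₁ := h.r₁_pos
  have hr₂ := h.r₂_pos
  have hε := h.eps_pos
  have hm := h.mean_pos
  have hmr := h.harmonic_mean
  set m := r₁ * r₂ / (r₁ + r₂)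
  have ht : 0 < r₁ + r₂ + 2 * ε := by positivity
  have hs : |a + b| ≤ 2 * ε := by
    have h1 := congrArg abs h.sum_eq
    rw [abs_mul, abs_of_pos ht, abs_mul, abs_of_pos (by positivity : 0 < 2 * ε)] at h1
    have h2 : |r₁ - r₂| ≤ r₁ + r₂ + 2 * ε := abs_le.2 ⟨by linarith, by linarith⟩
    refine le_of_mul_le_mul_right ?_ ht
    rw [h1]
    exact mul_le_mul_of_nonneg_left h2 (by positivity)
  have hN : -(a * b) ≤ 4 * m * ε + 4 * ε ^ 2 := by
    refine le_of_mul_le_mul_right ?_ ht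
    rw [h.prod_eq, ← hmr]
    have : 0 ≤ 8 * m * ε ^ 2 + ε ^ 2 * (r₁ + r₂) + 6 * ε ^ 3 := by positivity
    linarith
  have hs2 : (a + b) ^ 2 ≤ (2 * ε) ^ 2 := sq_le_sq' (abs_le.1 hs).1 (abs_le.1 hs).2
  rw [show (a - b) ^ 2 = (a + b) ^ 2 + 4 * -(a * b) by ring]
  linarith

lemma le_sq_sub (h : LimitPointRelations a b r₁ r₂ ε) :
    16 * ε * (r₁ * r₂) ≤ (a - b) ^ 2 * (r₁ + r₂ + 2 * ε) := by
  have hr₁ := h.r₁_pos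
  have hr₂ := h.r₂_pos
  have hε := h.eps_pos
  have ht : 0 < r₁ + r₂ + 2 * ε := by positivity
  rw [show (a - b) ^ 2 = (a + b) ^ 2 + 4 * -(a * b) by ring, add_mul, mul_assoc 4, h.prod_eq]
  have : 0 ≤ (a + b) ^ 2 * (r₁ + r₂ + 2 * ε) + 4 * (3 * ε ^ 2 * (r₁ + r₂) + 2 * ε ^ 3) := by
    positivity
  linarith

lemma sub_pos (h : LimitPointRelations a b r₁ r₂ ε) : 0 < a - b := by
  linarith [h.b_neg, h.a_pos]

lemma sq_factor (h : LimitPointRelations a b r₁ r₂ ε) :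
    (radiusFactor r₁ r₂ * Real.sqrt ε) ^ 2 = r₁ * r₂ / (r₁ + r₂) * ε := by
  rw [mul_pow, radiusFactor, Real.sq_sqrt h.mean_pos.le, Real.sq_sqrt h.eps_pos.le]

/-- The distance of the two limit points is `4 √(m ε) + O(ε)` with `m = r₁ r₂ / (r₁ + r₂)`. -/
lemma abs_sub_sub_le (h : LimitPointRelations a b r₁ r₂ ε) :
    |(a - b) - 4 * (radiusFactor r₁ r₂ * Real.sqrt ε)| ≤ 5 * ε := by
  have hr₁ := h.r₁_pos
  have hr₂ := h.r₂_pos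
  have hε := h.eps_pos
  have hm := h.mean_pos
  have hmr := h.harmonic_mean
  have hx := h.sub_pos
  have hup := h.sq_sub_le
  have hlow := h.le_sq_sub
  have hy2 := h.sq_factor
  have hy : 0 ≤ radiusFactor r₁ r₂ * Real.sqrt ε :=
    mul_nonneg (Real.sqrt_nonneg _) (Real.sqrt_nonneg _)
  set m := r₁ * r₂ / (r₁ + r₂)
  set y := radiusFactor r₁ r₂ * Real.sqrt ε
  set x := a - b
  -- The inequality 4m ≤ r₁ + r₂ makes the error a multiple of ε² independent of the radii.
  have hlow' : 16 * m * ε - 8 * ε ^ 2 ≤ x ^ 2 := by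
    have ht : 0 < r₁ + r₂ + 2 * ε := by positivity
    refine le_of_mul_le_mul_right (le_trans ?_ hlow) ht
    rw [← hmr]
    have h4 : 4 * m ≤ r₁ + r₂ := by
      refine le_of_mul_le_mul_right ?_ (add_pos hr₁ hr₂)
      rw [mul_assoc, hmr]
      nlinarith [sq_nonneg (r₁ - r₂)]
    nlinarith [mul_nonneg (mul_nonneg hε.le hε.le) (_root_.sub_nonneg.2 h4), pow_pos hε 3]
  have h1 : |x ^ 2 - (4 * y) ^ 2| ≤ 25 * ε ^ 2 := by
    rw [mul_pow, hy2, abs_le]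
    constructor <;> nlinarith
  -- As x and y are nonnegative, |x - 4y| ≤ x + 4y, so the square is at most |x² - 16y²|. No lower
  -- bound on y is needed.
  have h2 : |x - 4 * y| ^ 2 ≤ (5 * ε) ^ 2 := by
    calc |x - 4 * y| ^ 2 = |x - 4 * y| * |x - 4 * y| := sq _
      _ ≤ |x - 4 * y| * |x + 4 * y| := by
          refine mul_le_mul_of_nonneg_left ?_ (abs_nonneg _)
          rw [abs_of_nonneg (by positivity : 0 ≤ x + 4 * y), abs_le]
          constructor <;> linarith
      _ = |x ^ 2 - (4 * y) ^ 2| := by rw [← abs_mul]; congr 1; ring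
      _ ≤ _ := h1.trans (by linarith)
  exact (pow_le_pow_iff_left₀ (abs_nonneg _) (by positivity) two_ne_zero).1 h2

end LimitPointRelations

variable {f : ℂ → ℂ} {H : Plane → ℝ}

lemma exists_entire_of_entireHarmonic (hH : EntireHarmonic H) :
    ∃ f : ℂ → ℂ, Differentiable ℂ f ∧ ∀ z, H (planeIso z) = (f z).re := by
  obtain ⟨f, hf, hre⟩ := HarmonicOnNhd.exists_analyticOnNhd_univ_re_eq (f := H ∘ planeIso)
    fun z _ => harmonicAt_comp_planeIso (hH _ (mem_univ _))
  exact ⟨f, fun z => (hf z (mem_univ z)).differentiableAt, fun z => (congrFun hre z).symm⟩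

lemma hasGradientAt_of_entire (hf : Differentiable ℂ f) (hH : ∀ z, H (planeIso z) = (f z).re)
    (z : ℂ) : HasGradientAt H (planeIso (conj (deriv f z))) (planeIso z) :=
  hasGradientAt_of_re (hf z).hasDerivAt (Eventually.of_forall hH)

lemma partialOne_eq (hf : Differentiable ℂ f) (hH : ∀ z, H (planeIso z) = (f z).re) :
    partialOne H = (deriv f 0).re := by
  have h := (hasGradientAt_of_entire hf hH 0).hasFDerivAt
  rw [map_zero] at h
  have e : (EuclideanSpace.single 0 1 : Plane) = planeIso 1 := by
    rw [planeIso_apply]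
    ext i
    fin_cases i <;> simp
  rw [partialOne, h.fderiv, e, toDual_apply_apply, planeIso.inner_map_map, Complex.inner]
  simp

/-- A bound for f'' on the ball of radius R makes f - f'(0)z Lipschitz with constant Kd on the ball
of radius d. Taking d = x - y = a - b later yields an error K(a - b)² = O(ε). -/
lemma exists_taylor_bound (hf : Differentiable ℂ f) (R : ℝ) :
    ∃ K : ℝ, 0 ≤ K ∧ ∀ x y : ℂ, ∀ d : ℝ, d ≤ R → ‖x‖ ≤ d → ‖y‖ ≤ d →
      ‖f x - f y - deriv f 0 * (x - y)‖ ≤ K * d * ‖x - y‖ := by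
  have hf' : Differentiable ℂ (deriv f) := fun z => (hf.analyticAt z).deriv.differentiableAt
  have hf'' : Continuous (deriv (deriv f)) :=
    continuous_iff_continuousAt.2 fun z => (hf'.analyticAt z).deriv.continuousAt
  obtain ⟨K, hK⟩ := (isCompact_closedBall (0 : ℂ) R).exists_bound_of_continuousOn
    hf''.continuousOn
  refine ⟨max K 0, le_max_right _ _, fun x y d hd hx hy => ?_⟩
  have hd0 : 0 ≤ d := (norm_nonneg x).trans hx
  have hball : ∀ {z : ℂ}, ‖z‖ ≤ d → z ∈ closedBall (0 : ℂ) d := fun hz => by simpa using hz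
  have hlip : ∀ z ∈ closedBall (0 : ℂ) d, ‖deriv f z - deriv f 0‖ ≤ max K 0 * d := by
    intro z hz
    have := (convex_closedBall (0 : ℂ) d).norm_image_sub_le_of_norm_deriv_le
      (fun w _ => hf' w) (fun w hw => (hK w (closedBall_subset_closedBall hd hw)).trans
        (le_max_left K 0)) (hball (by simpa using hd0 : ‖(0 : ℂ)‖ ≤ d)) hz
    refine this.trans (mul_le_mul_of_nonneg_left ?_ (le_max_right _ _))
    simpa using hz
  have hg : ∀ z : ℂ, HasDerivAt (fun z => f z - deriv f 0 * z) (deriv f z - deriv f 0) z :=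
    fun z => ((hf z).hasDerivAt.sub ((hasDerivAt_id z).const_mul (deriv f 0))).congr_deriv
      (by rw [mul_one])
  have := (convex_closedBall (0 : ℂ) d).norm_image_sub_le_of_norm_hasDerivWithin_le
    (fun z _ => (hg z).hasDerivWithinAt) hlip (hball hy) (hball hx)
  refine le_of_eq_of_le (congrArg norm ?_) this
  ring

/-- The asymptotic expansion of the difference of the values at the limit points. -/
theorem exists_asymptotics (hf : Differentiable ℂ f) (hH : ∀ z, H (planeIso z) = (f z).re)
    (M : ℝ) : ∃ K : ℝ, ∀ a b r₁ r₂ ε : ℝ, LimitPointRelations a b r₁ r₂ ε →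
      r₁ * r₂ / (r₁ + r₂) ≤ M → ε ≤ 1 →
      |(H (planeIso a) - H (planeIso b)) -
        4 * partialOne H * radiusFactor r₁ r₂ * Real.sqrt ε| ≤ K * ε := by
  -- For ε ≤ 1 this R bounds both (a - b)²/ε and a - b.
  set R := 16 * |M| + 20 with hR
  obtain ⟨K, hK0, hK⟩ := exists_taylor_bound hf R
  -- KR comes from the Taylor remainder, the 5 from `abs_sub_sub_le`.
  refine ⟨K * R + |partialOne H| * 5, fun a b r₁ r₂ ε h hM hε1 => ?_⟩
  have hε := h.eps_pos
  have ha := h.a_pos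
  have hb := h.b_neg
  have hx := h.sub_pos
  have hMM := hM.trans (le_abs_self M)
  have hx2 : (a - b) ^ 2 ≤ R * ε := by
    have := h.sq_sub_le
    have h1 : r₁ * r₂ / (r₁ + r₂) * ε ≤ |M| * ε := mul_le_mul_of_nonneg_right hMM hε.le
    have h2 : ε ^ 2 ≤ ε := by nlinarith
    rw [hR]
    linarith
  have hR1 : 1 ≤ R := by have := abs_nonneg M; linarith
  have hxR : a - b ≤ R := by
    have h1 : (a - b) ^ 2 ≤ R ^ 2 := by nlinarith
    exact (pow_le_pow_iff_left₀ hx.le (by linarith) two_ne_zero).1 h1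
  have h1 := hK (a : ℂ) (b : ℂ) (a - b) hxR
    (by rw [Complex.norm_real, Real.norm_eq_abs, abs_of_pos ha]; linarith)
    (by rw [Complex.norm_real, Real.norm_eq_abs, abs_of_neg hb]; linarith)
  rw [← Complex.ofReal_sub a b, Complex.norm_real, Real.norm_eq_abs, abs_of_pos hx] at h1
  have h2 := (Complex.abs_re_le_norm _).trans h1
  rw [Complex.sub_re, Complex.sub_re, ← hH, ← hH, Complex.re_mul_ofReal,
    ← partialOne_eq hf hH] at h2
  have h3 : K * (a - b) * (a - b) ≤ K * (R * ε) := by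
    rw [mul_assoc, ← sq]; exact mul_le_mul_of_nonneg_left hx2 hK0
  have h4 := mul_le_mul_of_nonneg_left h.abs_sub_sub_le (abs_nonneg (partialOne H))
  rw [← abs_mul] at h4
  have e : (H (planeIso a) - H (planeIso b)) -
      4 * partialOne H * radiusFactor r₁ r₂ * Real.sqrt ε =
      (H (planeIso a) - H (planeIso b) - partialOne H * (a - b)) +
      partialOne H * ((a - b) - 4 * (radiusFactor r₁ r₂ * Real.sqrt ε)) := by ring
  rw [e]
  refine (abs_add_le _ _).trans ?_
  linarith

end Estimates

end TwoDisks

/-! ### Pointwise bounds for the gradient. -/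

namespace TwoDisks

open InnerProductSpace ComplexConjugate

section Gradient

variable {a b r₁ r₂ ε C₁ C₂ : ℝ} {f : ℂ → ℂ} {H u : Plane → ℝ}

/-- On the gap between the disks the mean value theorem gives a point with large gradient. -/
lemma IsSolution.exists_le_norm_gradient (hu : IsSolution r₁ r₂ ε H u C₁ C₂) (hr₁ : 0 < r₁)
    (hr₂ : 0 < r₂) (hε : 0 < ε) :
    ∃ t : ℝ, -ε < t ∧ t < ε ∧ |C₁ - C₂| / (2 * ε) ≤ ‖gradient u (!₂[t, 0] : Plane)‖ := by
  have hn₁ : ∀ t : ℝ, t ≤ ε → ‖(t : ℂ) - ((r₁ + ε : ℝ) : ℂ)‖ = r₁ + ε - t := fun t ht => by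
    rw [← Complex.ofReal_sub, Complex.norm_real, Real.norm_eq_abs, abs_sub_comm,
      abs_of_nonneg (by linarith)]
  have hn₂ : ∀ t : ℝ, -ε ≤ t → ‖(t : ℂ) - ((-r₂ - ε : ℝ) : ℂ)‖ = t + r₂ + ε := fun t ht => by
    rw [← Complex.ofReal_sub, Complex.norm_real, Real.norm_eq_abs, abs_of_nonneg (by linarith)]
    ring
  have hd : ∀ t ∈ Ioo (-ε) ε, HasDerivAt (fun t : ℝ => u (planeIso t))
      (inner ℝ (gradient u (planeIso t)) (planeIso 1)) t := by
    intro t ht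
    have hmem : (t : ℂ) ∈ openExt r₁ r₂ ε :=
      ⟨by rw [hn₁ t ht.2.le]; linarith [ht.2], by rw [hn₂ t ht.1.le]; linarith [ht.1]⟩
    have h1 := ((hu.harmonic _ ((planeIso_mem_compl_closure hr₁ hr₂).2 hmem)).1.differentiableAt
      two_ne_zero).hasGradientAt.hasFDerivAt
    have h2 : HasDerivAt (fun t : ℝ => planeIso (t : ℂ)) (planeIso 1) t :=
      planeIso.toContinuousLinearEquiv.hasFDerivAt.comp_hasDerivAt t
        (Complex.ofRealCLM.hasDerivAt)
    have h3 := h1.comp_hasDerivAt t h2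
    rwa [toDual_apply_apply] at h3
  have hc : ContinuousOn (fun t : ℝ => u (planeIso t)) (Icc (-ε) ε) := by
    refine hu.continuousOn.comp (planeIso.continuous.comp Complex.continuous_ofReal).continuousOn
      fun t ht => planeIso_mem_compl_disks.2 ?_
    exact ⟨by rw [hn₁ t ht.2]; linarith [ht.2], by rw [hn₂ t ht.1]; linarith [ht.1]⟩
  obtain ⟨t, ht, hslope⟩ := exists_hasDerivAt_eq_slope _ _ (by linarith : -ε < ε) hc hd
  refine ⟨t, ht.1, ht.2, ?_⟩
  rw [hu.apply_left (z := (ε : ℂ)) (by rw [hn₁ ε le_rfl]; ring),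
    hu.apply_right (z := ((-ε : ℝ) : ℂ)) (by rw [hn₂ (-ε) le_rfl]; ring)] at hslope
  rw [← planeIso_ofReal]
  calc |C₁ - C₂| / (2 * ε) = |(C₁ - C₂) / (ε - -ε)| := by
        rw [abs_div, sub_neg_eq_add, ← two_mul, abs_of_pos (by positivity : 0 < 2 * ε)]
    _ = ‖inner ℝ (gradient u (planeIso t)) (planeIso 1)‖ := by rw [← hslope, Real.norm_eq_abs]
    _ ≤ ‖gradient u (planeIso t)‖ * ‖planeIso 1‖ := norm_inner_le_norm _ _
    _ = _ := by rw [planeIso.norm_map, norm_one, mul_one]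

/-- A value above the essential supremum would persist, by continuity, on a nonempty open set, which
has positive measure. -/
lemma enorm_le_eLpNorm_top {g : Plane → Plane} (hg : Continuous g) {S : Set Plane}
    (hS : IsOpen S) {x : Plane} (hx : x ∈ S) : ‖g x‖ₑ ≤ eLpNorm g ⊤ (volume.restrict S) := by
  rw [eLpNorm_exponent_top]
  set N := eLpNormEssSup g (volume.restrict S) with hN
  have hae : ∀ᵐ y ∂(volume.restrict S), ‖g y‖ₑ ≤ N := ae_le_essSup
  rw [ae_restrict_iff' hS.measurableSet] at hae
  by_contra! hlt
  have hopen : IsOpen (S ∩ {y | N < ‖g y‖ₑ}) :=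
    hS.inter (isOpen_lt continuous_const hg.enorm)
  have hpos := hopen.measure_pos volume ⟨x, hx, hlt⟩
  refine hpos.ne' (measure_mono_null (fun y hy => ?_) hae)
  exact fun h => not_lt.2 (h hy.1) hy.2

lemma norm_deriv_le_gradSup (hf : Differentiable ℂ f) (hH : ∀ z, H (planeIso z) = (f z).re)
    {S : Set Plane} (hS : IsOpen S) (htop : gradSup H S ≠ ⊤) {z : ℂ} (hz : planeIso z ∈ S) :
    ‖deriv f z‖ ≤ (gradSup H S).toReal := by
  have hgrad : gradient H = fun x => planeIso (conj (deriv f (planeIso.symm x))) := by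
    ext1 x
    have := (hasGradientAt_of_entire hf hH (planeIso.symm x)).gradient
    rwa [planeIso.apply_symm_apply] at this
  have hcd : Continuous (deriv f) :=
    continuous_iff_continuousAt.2 fun z => (hf.analyticAt z).deriv.continuousAt
  have hc : Continuous (gradient H) := by
    rw [hgrad]
    exact planeIso.continuous.comp
      (Complex.continuous_conj.comp (hcd.comp planeIso.symm.continuous))
  have h := enorm_le_eLpNorm_top hc hS hz
  have hn : ‖gradient H (planeIso z)‖ = ‖deriv f z‖ := by
    rw [hgrad]
    simp only [planeIso.symm_apply_apply, planeIso.norm_map, Complex.norm_conj]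
  rw [← hn, ← toReal_enorm]
  exact ENNReal.toReal_mono htop h

/-- The two circles are null sets, so a bound in the open exterior suffices. -/
lemma gradSup_le {K : ℝ} {S : Set Plane} (hS : MeasurableSet S)
    (h : ∀ z ∈ openExt r₁ r₂ ε, planeIso z ∈ S → ‖gradient u (planeIso z)‖ ≤ K) :
    gradSup u (S \ (disk₁ r₁ ε ∪ disk₂ r₂ ε)) ≤ ENNReal.ofReal K := by
  rw [gradSup, eLpNorm_exponent_top]
  refine eLpNormEssSup_le_of_ae_bound ?_
  have hD : MeasurableSet (disk₁ r₁ ε ∪ disk₂ r₂ ε) := measurableSet_ball.union measurableSet_ball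
  rw [ae_restrict_iff' (hS.diff hD)]
  have h1 : ∀ᵐ x : Plane, x ∉ sphere (center₁ r₁ ε) r₁ :=
    measure_eq_zero_iff_ae_notMem.1 (Measure.addHaar_sphere volume _ _)
  have h2 : ∀ᵐ x : Plane, x ∉ sphere (center₂ r₂ ε) r₂ :=
    measure_eq_zero_iff_ae_notMem.1 (Measure.addHaar_sphere volume _ _)
  filter_upwards [h1, h2] with x hx1 hx2 hx
  obtain ⟨z, rfl⟩ := planeIso.surjective x
  refine h z ?_ hx.1
  have hc : z ∈ closedExt r₁ r₂ ε := planeIso_mem_compl_disks.1 hx.2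
  by_contra hnot
  rcases mem_boundary hc hnot with h | h
  · exact hx1 (by rw [mem_sphere, center₁_eq, dist_planeIso, h])
  · exact hx2 (by rw [mem_sphere, center₂_eq, dist_planeIso, h])

namespace LimitPointRelations

variable {ρ : ℝ}

lemma sub_le_half (h : LimitPointRelations a b r₁ r₂ ε)
    (hρ : r₁ * r₂ / (r₁ + r₂) ≤ ρ) (hε : ε ≤ ρ / 100) : a - b ≤ ρ / 2 := by
  have hε0 := h.eps_pos
  have hm := h.mean_pos
  have h1 := h.sq_sub_le
  have hρ0 : 0 < ρ := by linarith
  refine (pow_le_pow_iff_left₀ h.sub_pos.le (by positivity) two_ne_zero).1 (h1.trans ?_)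
  have h2 : r₁ * r₂ / (r₁ + r₂) * ε ≤ ρ * (ρ / 100) := mul_le_mul hρ hε hε0.le hρ0.le
  have h3 : ε ^ 2 ≤ (ρ / 100) ^ 2 := pow_le_pow_left₀ hε0.le hε 2
  nlinarith

/-- For small `ε` the multiplier stays away from `1` by a multiple of `√(ε / m)`. -/
lemma le_one_sub_multiplier (h : LimitPointRelations a b r₁ r₂ ε) (h₁ : ρ ≤ r₁) (h₂ : ρ ≤ r₂)
    (hρ : r₁ * r₂ / (r₁ + r₂) ≤ ρ) (hε : ε ≤ ρ / 100) :
    Real.sqrt ε ≤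
      2 * radiusFactor r₁ r₂ * (1 - multiplier a b (r₁ + ε) (-r₂ - ε)) := by
  have hr₁ := h.r₁_pos
  have hr₂ := h.r₂_pos
  have hε0 := h.eps_pos
  have ha := h.a_pos
  have hb := h.b_neg
  have hm := h.mean_pos
  have hmr := h.harmonic_mean
  have hx := h.sub_le_half hρ hε
  have hx0 := h.sub_pos
  have hρ0 : 0 < ρ := by linarith
  have d₁ : 0 < r₁ + ε - b := by linarith
  have d₂ : 0 < r₂ + ε + a := by linarith
  -- Over the common denominator (c₁ - b)(c₂ - a) the numerator of 1 - k₁k₂ factors, up to sign, as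
  -- (c₁ - c₂)(a - b).
  have e : 1 - multiplier a b (r₁ + ε) (-r₂ - ε) =
      (r₁ + r₂ + 2 * ε) * (a - b) / ((r₁ + ε - b) * (r₂ + ε + a)) := by
    have d₂' : -r₂ - ε - a ≠ 0 := by linarith
    rw [multiplier, ratio, ratio, eq_div_iff (by positivity)]
    field_simp
    ring
  have hsq := h.le_sq_sub
  have hF : 0 < radiusFactor r₁ r₂ := Real.sqrt_pos.2 hm
  have hF2 : radiusFactor r₁ r₂ ^ 2 = r₁ * r₂ / (r₁ + r₂) := Real.sq_sqrt hm.le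
  set F := radiusFactor r₁ r₂
  have hs2 : Real.sqrt ε ^ 2 = ε := Real.sq_sqrt hε0.le
  have hs0 : 0 < Real.sqrt ε := Real.sqrt_pos.2 hε0
  set s := Real.sqrt ε
  rw [← hF2] at hmr
  have hx2 : 8 * (s * F) ^ 2 ≤ (a - b) ^ 2 := by
    have h3 : r₁ + r₂ + 2 * ε ≤ 2 * (r₁ + r₂) := by linarith
    have h4 := hsq.trans (mul_le_mul_of_nonneg_left h3 (sq_nonneg (a - b)))
    rw [← hmr] at h4
    rw [mul_pow, hs2]
    nlinarith [add_pos hr₁ hr₂]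
  have hx3 : 2 * (s * F) ≤ a - b := by
    refine (pow_le_pow_iff_left₀ (by positivity) hx0.le two_ne_zero).1 ?_
    nlinarith [sq_nonneg (s * F)]
  -- Both ε - b and ε + a are at most ρ/100 + ρ/2, hence below each radius.
  have hden : (r₁ + ε - b) * (r₂ + ε + a) ≤ (2 * r₁) * (2 * r₂) :=
    mul_le_mul (by linarith) (by linarith) d₂.le (by positivity)
  rw [e, ← mul_div_assoc, le_div_iff₀ (by positivity)]
  calc s * ((r₁ + ε - b) * (r₂ + ε + a)) ≤ s * ((2 * r₁) * (2 * r₂)) :=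
        mul_le_mul_of_nonneg_left hden hs0.le
    _ = 2 * F * ((r₁ + r₂) * (2 * (s * F))) := by linear_combination (-4) * s * hmr
    _ ≤ 2 * F * ((r₁ + r₂ + 2 * ε) * (a - b)) := by
        refine mul_le_mul_of_nonneg_left ?_ (by positivity)
        exact mul_le_mul (by linarith) hx3 (by positivity) (by positivity)

/-- Both ratios are at least 1/4 because a - b is small against the radii; then k|v|² ≤ 1 forces |v|
≤ 2. -/
lemma norm_div_le_two (h : LimitPointRelations a b r₁ r₂ ε) (hL : DiskLimitPoints a b r₁ r₂ ε)
    (h₁ : ρ ≤ r₁) (h₂ : ρ ≤ r₂) (hρ : r₁ * r₂ / (r₁ + r₂) ≤ ρ) (hε : ε ≤ ρ / 100) {z : ℂ}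
    (hz : z ∈ closedExt r₁ r₂ ε) : ‖(z - a) / (z - b)‖ ≤ 2 ∧ ‖(z - b) / (z - a)‖ ≤ 2 := by
  have hε0 := h.eps_pos
  have ha := h.a_pos
  have hb := h.b_neg
  have hm := h.mean_pos
  have hx := h.sub_le_half hρ hε
  have key : ∀ (k : ℝ) (v : ℂ), 1 / 4 ≤ k → k * ‖v‖ ^ 2 ≤ 1 → ‖v‖ ≤ 2 := fun k v hk hv => by
    refine (pow_le_pow_iff_left₀ (norm_nonneg v) zero_le_two two_ne_zero).1 ?_
    nlinarith [sq_nonneg ‖v‖]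
  refine ⟨key _ _ ?_ (hL.symm.ratio_mul_sq_le hz.2), key _ _ ?_ (hL.ratio_mul_sq_le hz.1)⟩
  · rw [ratio, ← neg_div_neg_eq (-r₂ - ε - b), le_div_iff₀ (by linarith)]
    linarith
  · rw [ratio, le_div_iff₀ (by linarith)]
    linarith

end LimitPointRelations

/-- The pointwise gradient bound, in terms of a bound for the gradient of the background
potential on the larger ball. -/
theorem IsSolution.norm_gradient_le (hu : IsSolution r₁ r₂ ε H u C₁ C₂)
    (hL : DiskLimitPoints a b r₁ r₂ ε) (h : LimitPointRelations a b r₁ r₂ ε)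
    (hε : ε ≤ min r₁ r₂ / 100)
    (hf : Differentiable ℂ f) (hH : ∀ z, H (planeIso z) = (f z).re) {B : ℝ}
    (hB : ∀ z : ℂ, planeIso z ∈ bigDomain r₁ r₂ → ‖deriv f z‖ ≤ B) {z : ℂ}
    (hz : z ∈ openExt r₁ r₂ ε) (hzΩ : planeIso z ∈ bigDomain r₁ r₂) :
    ‖gradient u (planeIso z)‖ ≤ 202 * radiusFactor r₁ r₂ / Real.sqrt ε * B := by
  have hr₁ := h.r₁_pos
  have hr₂ := h.r₂_pos
  have hε0 := h.eps_pos
  have h₁ := min_le_left r₁ r₂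
  have h₂ := min_le_right r₁ r₂
  have hρ : r₁ * r₂ / (r₁ + r₂) ≤ min r₁ r₂ := by
    rw [div_le_iff₀ (by positivity)]
    rcases min_cases r₁ r₂ with ⟨e, _⟩ | ⟨e, _⟩ <;> rw [e] <;> nlinarith
  have hB0 : 0 ≤ B := (norm_nonneg _).trans (hB z hzΩ)
  have hzc := openExterior_subset hz
  -- Ω contains both closed disks, where the image points lie.
  have hmem : ∀ (c r : ℝ) (x : ℂ), |c| + r < 4 * (r₁ + r₂) → ‖x - c‖ ≤ r →
      planeIso x ∈ bigDomain r₁ r₂ := by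
    intro c r x hc hx
    rw [bigDomain, mem_ball, dist_zero_right, planeIso.norm_map]
    have h3 := norm_sub_norm_le x c
    rw [Complex.norm_real, Real.norm_eq_abs] at h3
    linarith
  obtain ⟨D, hD, hbound⟩ := hL.hasDerivAt_potential hf hzc.1 hzc.2
  obtain ⟨hv, hv'⟩ := h.norm_div_le_two hL h₁ h₂ hρ hε hzc
  have hnorm := hbound B hv hv' (hB z hzΩ)
    (fun x hx => hB x (hmem _ _ x (by rw [abs_of_pos (by linarith)]; linarith) hx))
    (fun x hx => hB x (hmem _ _ x (by rw [abs_of_neg (by linarith)]; linarith) hx))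
  rw [hu.gradient_eq hε0 hL hf hH hz, planeIso.norm_map, Complex.norm_conj, hD.deriv]
  refine hnorm.trans ?_
  have hlam := h.le_one_sub_multiplier h₁ h₂ hρ hε
  set q := 1 - multiplier a b (r₁ + ε) (-r₂ - ε)
  have hq0 : 0 < q := sub_pos.2 hL.multiplier_lt_one
  have hq1 : q ≤ 1 := sub_le_self _ hL.multiplier_pos.le
  have hs0 : 0 < Real.sqrt ε := Real.sqrt_pos.2 hε0
  have hinv : 1 / q ≤ 2 * radiusFactor r₁ r₂ / Real.sqrt ε := by
    rw [div_le_div_iff₀ hq0 hs0]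
    linarith
  have hone : 1 ≤ 1 / q := (one_le_div hq0).2 hq1
  -- Four sums at 25 each plus the term f' give 101/q, as q ≤ 1; the factor 2 in the bound for 1/q
  -- makes 202.
  calc B + 4 * (25 * B / q) ≤ B * (101 * (1 / q)) := by
        have : B * 1 ≤ B * (1 / q) := mul_le_mul_of_nonneg_left hone hB0
        have e : 4 * (25 * B / q) = 100 * (B * (1 / q)) := by ring
        rw [e]
        linarith
    _ ≤ B * (101 * (2 * radiusFactor r₁ r₂ / Real.sqrt ε)) := by gcongr
    _ = _ := by ring

end Gradient

end TwoDisks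

/-! ### Lower and upper bounds for small ε. -/

namespace TwoDisks

open InnerProductSpace ComplexConjugate

variable {r₁ r₂ ε : ℝ}

lemma exists_limitPoints (hr₁ : 0 < r₁) (hr₂ : 0 < r₂) (hε : 0 < ε) :
    ∃ a b : ℝ, DiskLimitPoints a b r₁ r₂ ε ∧ LimitPointRelations a b r₁ r₂ ε := by
  obtain ⟨a, b, hL, hb, ha, hs, hp⟩ := exists_diskLimitPoints hr₁ hr₂ hε
  exact ⟨a, b, hL, ⟨hr₁, hr₂, hε, hb, ha, hs, hp⟩⟩

theorem exists_lower_bound {H : Plane → ℝ} (hH : EntireHarmonic H) (hr₁ : 0 < r₁) (hr₂ : 0 < r₂) :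
    ∃ ε₀ : ℝ, 0 < ε₀ ∧ ∀ (ε : ℝ) (u : Plane → ℝ) (C₁ C₂ : ℝ), 0 < ε → ε < ε₀ →
      IsSolution r₁ r₂ ε H u C₁ C₂ →
      ∃ t : ℝ, -ε < t ∧ t < ε ∧
        |partialOne H| * radiusFactor r₁ r₂ / Real.sqrt ε ≤ ‖gradient u (!₂[t, 0] : Plane)‖ := by
  obtain ⟨f, hf, hHf⟩ := exists_entire_of_entireHarmonic hH
  obtain ⟨K, hK⟩ := exists_asymptotics hf hHf (r₁ * r₂ / (r₁ + r₂))
  have hF : 0 < radiusFactor r₁ r₂ := Real.sqrt_pos.2 (by positivity)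
  set F := radiusFactor r₁ r₂
  by_cases hP : partialOne H = 0
  · refine ⟨1, one_pos, fun ε u C₁ C₂ hε _ _ => ⟨0, by linarith, hε, ?_⟩⟩
    rw [hP, abs_zero, zero_mul, zero_div]
    exact norm_nonneg _
  have hP0 : 0 < |partialOne H| := abs_pos.2 hP
  -- For √ε < δ the error Kε is at most half of the main term 4|∂₁H|F√ε. The remaining half, divided
  -- by the gap length 2ε, is the claimed bound.
  set δ := 2 * |partialOne H| * F / (|K| + 1) with hδ
  have hδ0 : 0 < δ := by positivity
  refine ⟨min 1 (δ ^ 2), by positivity, fun ε u C₁ C₂ hε hε₀ hu => ?_⟩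
  have hε1 : ε ≤ 1 := (hε₀.trans_le (min_le_left _ _)).le
  have hs0 : 0 < Real.sqrt ε := Real.sqrt_pos.2 hε
  have hsδ : Real.sqrt ε < δ :=
    (Real.sqrt_lt' hδ0).2 (hε₀.trans_le (min_le_right _ _))
  have hss : Real.sqrt ε * Real.sqrt ε = ε := Real.mul_self_sqrt hε.le
  obtain ⟨a, b, hL, hrel⟩ := exists_limitPoints hr₁ hr₂ hε
  obtain ⟨t, ht1, ht2, ht⟩ := hu.exists_le_norm_gradient hr₁ hr₂ hε
  refine ⟨t, ht1, ht2, le_trans ?_ ht⟩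
  have hasym := hK a b r₁ r₂ ε hrel le_rfl hε1
  rw [← hu.sub_eq hε hL hf hHf] at hasym
  set s := Real.sqrt ε
  have hKs : |K| * s ≤ 2 * |partialOne H| * F := by
    have h1 : s * (|K| + 1) ≤ 2 * |partialOne H| * F :=
      (le_div_iff₀ (by positivity)).1 hsδ.le
    linarith
  have hKε : K * ε ≤ 2 * |partialOne H| * F * s := by
    calc K * ε ≤ |K| * ε := mul_le_mul_of_nonneg_right (le_abs_self K) hε.le
      _ = |K| * s * s := by rw [mul_assoc, hss]
      _ ≤ _ := mul_le_mul_of_nonneg_right hKs hs0.le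
  have hmain : |4 * partialOne H * F * s| = 4 * |partialOne H| * F * s := by
    rw [abs_mul, abs_mul, abs_mul, abs_of_pos hF, abs_of_pos hs0]
    norm_num
  have htri := abs_sub_abs_le_abs_sub (4 * partialOne H * F * s) (C₁ - C₂)
  rw [abs_sub_comm (4 * partialOne H * F * s), hmain] at htri
  change |C₁ - C₂ - 4 * partialOne H * F * s| ≤ K * ε at hasym
  have hlow : 2 * |partialOne H| * F * s ≤ |C₁ - C₂| := by linarith
  rw [div_le_div_iff₀ hs0 (by positivity)]
  calc |partialOne H| * F * (2 * ε) = 2 * |partialOne H| * F * s * s := by rw [← hss]; ring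
    _ ≤ |C₁ - C₂| * s := mul_le_mul_of_nonneg_right hlow hs0.le

theorem gradSup_le_of_small (hr₁ : 0 < r₁) (hr₂ : 0 < r₂) (hε : 0 < ε)
    (hε₀ : ε ≤ min r₁ r₂ / 100) {H u : Plane → ℝ} {C₁ C₂ : ℝ} (hH : EntireHarmonic H)
    (hu : IsSolution r₁ r₂ ε H u C₁ C₂) :
    gradSup u (bigDomain r₁ r₂ \ (disk₁ r₁ ε ∪ disk₂ r₂ ε)) ≤
      ENNReal.ofReal (202 * radiusFactor r₁ r₂ / Real.sqrt ε) * gradSup H (bigDomain r₁ r₂) := by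
  have hF : 0 < radiusFactor r₁ r₂ := Real.sqrt_pos.2 (by positivity)
  have hs0 : 0 < Real.sqrt ε := Real.sqrt_pos.2 hε
  have hpos : 0 < 202 * radiusFactor r₁ r₂ / Real.sqrt ε := by positivity
  by_cases htop : gradSup H (bigDomain r₁ r₂) = ⊤
  · rw [htop, ENNReal.mul_top (by simpa using hpos)]
    exact le_top
  obtain ⟨f, hf, hHf⟩ := exists_entire_of_entireHarmonic hH
  obtain ⟨a, b, hL, hrel⟩ := exists_limitPoints hr₁ hr₂ hε
  rw [← ENNReal.ofReal_toReal htop, ← ENNReal.ofReal_mul hpos.le]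
  exact gradSup_le measurableSet_ball fun z hz hzΩ =>
    hu.norm_gradient_le hL hrel hε₀ hf hHf
      (fun w hw => norm_deriv_le_gradSup hf hHf isOpen_ball htop hw) hz hzΩ

end TwoDisks

end

theorem proposition3p2 :
    -- the fixed points exist, are unique, and are exchanged by the reflections
    (∀ r₁ r₂ ε : ℝ, 0 < r₁ → 0 < r₂ → 0 < ε →
      (∃! p : Plane, TwoDisks.IsFixedPoint₁ r₁ r₂ ε p) ∧
      (∃! p : Plane, TwoDisks.IsFixedPoint₂ r₁ r₂ ε p) ∧
      ∀ p₁ p₂ : Plane, TwoDisks.IsFixedPoint₁ r₁ r₂ ε p₁ → TwoDisks.IsFixedPoint₂ r₁ r₂ ε p₂ →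
        TwoDisks.reflection₂ r₂ ε p₁ = p₂ ∧ TwoDisks.reflection₁ r₁ ε p₂ = p₁) ∧
    -- the exact formula for the potential difference
    (∀ (r₁ r₂ ε : ℝ) (H u : Plane → ℝ) (C₁ C₂ : ℝ) (p₁ p₂ : Plane),
      0 < r₁ → 0 < r₂ → 0 < ε → TwoDisks.EntireHarmonic H →
      TwoDisks.IsSolution r₁ r₂ ε H u C₁ C₂ →
      TwoDisks.IsFixedPoint₁ r₁ r₂ ε p₁ → TwoDisks.IsFixedPoint₂ r₁ r₂ ε p₂ →
      C₁ - C₂ = H p₁ - H p₂) ∧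
    -- its asymptotics; the constant depends only on `H` and an upper bound for `r₁r₂/(r₁+r₂)`
    (∀ H : Plane → ℝ, TwoDisks.EntireHarmonic H → ∀ M : ℝ, ∃ K : ℝ,
      ∀ (r₁ r₂ ε : ℝ) (p₁ p₂ : Plane), 0 < r₁ → 0 < r₂ → r₁ * r₂ / (r₁ + r₂) ≤ M →
        0 < ε → ε ≤ 1 →
        TwoDisks.IsFixedPoint₁ r₁ r₂ ε p₁ → TwoDisks.IsFixedPoint₂ r₁ r₂ ε p₂ →
        |(H p₁ - H p₂) -
          4 * TwoDisks.partialOne H * TwoDisks.radiusFactor r₁ r₂ * Real.sqrt ε| ≤ K * ε) ∧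
    -- the lower bound for the gradient at a point of the gap
    (∀ (H : Plane → ℝ) (r₁ r₂ : ℝ), TwoDisks.EntireHarmonic H → 0 < r₁ → 0 < r₂ →
      ∃ ε₀ : ℝ, 0 < ε₀ ∧ ∀ (ε : ℝ) (u : Plane → ℝ) (C₁ C₂ : ℝ), 0 < ε → ε < ε₀ →
        TwoDisks.IsSolution r₁ r₂ ε H u C₁ C₂ →
        ∃ t : ℝ, -ε < t ∧ t < ε ∧
          |TwoDisks.partialOne H| * TwoDisks.radiusFactor r₁ r₂ / Real.sqrt ε ≤
            ‖gradient u (!₂[t, 0] : Plane)‖) ∧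
    -- the upper bound for the gradient, with an absolute constant
    (∃ C : ℝ, 0 < C ∧ ∀ r₁ r₂ : ℝ, 0 < r₁ → 0 < r₂ →
      ∃ ε₀ : ℝ, 0 < ε₀ ∧ ∀ (ε : ℝ) (H u : Plane → ℝ) (C₁ C₂ : ℝ), 0 < ε → ε < ε₀ →
        TwoDisks.EntireHarmonic H → TwoDisks.IsSolution r₁ r₂ ε H u C₁ C₂ →
        TwoDisks.gradSup u
            (TwoDisks.bigDomain r₁ r₂ \ (TwoDisks.disk₁ r₁ ε ∪ TwoDisks.disk₂ r₂ ε)) ≤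
          ENNReal.ofReal (C * TwoDisks.radiusFactor r₁ r₂ / Real.sqrt ε) *
            TwoDisks.gradSup H (TwoDisks.bigDomain r₁ r₂)) := by
  refine ⟨fun r₁ r₂ ε hr₁ hr₂ hε => ?_, fun r₁ r₂ ε H u C₁ C₂ p₁ p₂ hr₁ hr₂ hε hH hu h₁ h₂ => ?_,
    fun H hH M => ?_, fun H r₁ r₂ hH hr₁ hr₂ => TwoDisks.exists_lower_bound hH hr₁ hr₂,
    202, by norm_num, fun r₁ r₂ hr₁ hr₂ => ⟨min r₁ r₂ / 100, by positivity,
      fun ε H u C₁ C₂ hε hε₀ hH hu =>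
        TwoDisks.gradSup_le_of_small hr₁ hr₂ hε hε₀.le hH hu⟩⟩
  · obtain ⟨a, b, hL, -⟩ := TwoDisks.exists_limitPoints hr₁ hr₂ hε
    have i₁ := fun p => TwoDisks.DiskLimitPoints.fixedPoint₁_iff hL hε (p := p)
    have i₂ := fun p => TwoDisks.DiskLimitPoints.fixedPoint₂_iff hL hε (p := p)
    refine ⟨⟨_, (i₁ _).2 rfl, fun p hp => (i₁ p).1 hp⟩, ⟨_, (i₂ _).2 rfl, fun p hp => (i₂ p).1 hp⟩,
      fun p₁ p₂ h₁ h₂ => ?_⟩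
    rw [(i₁ p₁).1 h₁, (i₂ p₂).1 h₂, TwoDisks.reflection₁, TwoDisks.reflection₂,
      TwoDisks.center₁_eq, TwoDisks.center₂_eq]
    exact ⟨hL.right.inversion_right, hL.left.inversion_right⟩
  · obtain ⟨a, b, hL, -⟩ := TwoDisks.exists_limitPoints hr₁ hr₂ hε
    obtain ⟨f, hf, hHf⟩ := TwoDisks.exists_entire_of_entireHarmonic hH
    rw [(TwoDisks.DiskLimitPoints.fixedPoint₁_iff hL hε).1 h₁,
      (TwoDisks.DiskLimitPoints.fixedPoint₂_iff hL hε).1 h₂]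
    exact hu.sub_eq hε hL hf hHf
  · obtain ⟨f, hf, hHf⟩ := TwoDisks.exists_entire_of_entireHarmonic hH
    obtain ⟨K, hK⟩ := TwoDisks.exists_asymptotics hf hHf M
    refine ⟨K, fun r₁ r₂ ε p₁ p₂ hr₁ hr₂ hM hε hε1 h₁ h₂ => ?_⟩
    obtain ⟨a, b, hL, hrel⟩ := TwoDisks.exists_limitPoints hr₁ hr₂ hε
    rw [(TwoDisks.DiskLimitPoints.fixedPoint₁_iff hL hε).1 h₁,
      (TwoDisks.DiskLimitPoints.fixedPoint₂_iff hL hε).1 h₂]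
    exact hK a b r₁ r₂ ε hrel hM hε1
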